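/- Let $\mathfrak g$ be a finite-dimensional simple Lie algebra over $\mathbb C$ with a Cartan subalgebra $\mathfrak h$, root system $R$, a base of simple roots $\alpha_i$ ($i\in I$), positive roots $R^+$, and a Chevalley basis with root vectors $x_\alpha^\pm\in\mathfrak g_{\pm\alpha}$ ($\alpha\in R^+$). Let $\sigma$ be a diagram automorphism, acting on $R$ by $\sigma(\sum n_i\alpha_i)=\sum n_i\alpha_{\sigma(i)}$ and on $\mathfrak g$ as the Lie algebra automorphism with $\sigma(x_{\alpha_i}^\pm)=x_{\alpha_{\sigma(i)}}^\pm$; let $m\in\{1,2,3\}$ be its order, $\zeta\in\mathbb C$ a primitive $m$-th root of unity, and $O\subseteq R^+$ a complete set of representatives of the $\sigma$-orbits on $R^+$. Let $\tilde{\mathfrak g}=\mathfrak g\otimes\mathbb C[t,t^{-1}]$, and let $\tilde{\mathfrak g}^\sigma$ be the subalgebra of fixed points of $x\otimes t^j\mapsto \zeta^j\sigma(x)\otimes t^j$. For $\alpha\in R^+$ and $\epsilon\in\mathbb Z$ set $x_{\alpha,\epsilon}^\pm=c_\alpha\sum_{j=0}^{m-1}\zeta^{-j\epsilon}\sigma^j(x_\alpha^\pm)$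 if $\sigma(\alpha)\neq\alpha$, where $c_\alpha=\sqrt2$ if $\alpha+\sigma(\alpha)\in R$ and $c_\alpha=1$ otherwise; if $\sigma(\alpha)=\alpha$, set $x_{\alpha,\epsilon}^\pm=x_\alpha^\pm$ if $\sigma(x_\alpha^\pm)=\zeta^\epsilon x_\alpha^\pm$ and $x_{\alpha,\epsilon}^\pm=0$ otherwise. Write $a^{(k)}=a^k/k!$. Let $U_{\mathbb Z}(\tilde{\mathfrak g})\subseteq U(\tilde{\mathfrak g})$ be the subring generated by all $(x_\alpha^\pm\otimes t^r)^{(k)}$ with $\alpha\in R^+$, $r\in\mathbb Z$, $k\ge0$, and let $U_{\mathbb Z}(\tilde{\mathfrak g}^\sigma)\subseteq U(\tilde{\mathfrak g}^\sigma)$ be the subring generated by all $(x_{\alpha,-r}^\pm\otimes t^r)^{(k)}$ with $\alpha\in O$, $r\in\mathbb Z$, $k\ge0$. Let $\mathbb F$ be an algebraically closed field whose characteristic is not $m$, and put $U_{\mathbb F}(\tilde{\mathfrak g})=\mathbb F\otimes_{\mathbb Z}U_{\mathbb Z}(\tilde{\mathfrak g})$ and $U_{\mathbb F}(\tilde{\mathfrak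 g}^\sigma)=\mathbb F\otimes_{\mathbb Z}U_{\mathbb Z}(\tilde{\mathfrak g}^\sigma)$. Fix a ring homomorphism $\chi:\mathbb Z[\zeta,\sqrt2]\to\mathbb F$. There is exactly one $\mathbb F$-algebra homomorphism $\iota:U_{\mathbb F}(\tilde{\mathfrak g}^\sigma)\to U_{\mathbb F}(\tilde{\mathfrak g})$ induced by the inclusion $\tilde{\mathfrak g}^\sigma\subseteq\tilde{\mathfrak g}$, in the sense that each $u\in U_{\mathbb Z}(\tilde{\mathfrak g}^\sigma)$ has in $U(\tilde{\mathfrak g})$ an expression $u=\sum_i s_iv_i$ with $s_i\in\mathbb Z[\zeta,\sqrt2]$ and $v_i\in U_{\mathbb Z}(\tilde{\mathfrak g})$ for which $\iota(1\otimes u)=\sum_i\chi(s_i)\otimes v_i$. For $\alpha\in R^+$ and a Laurent polynomial $p=\sum_i c_it^i$ over $\mathbb F$, let $(x_\alpha^\pm\otimes p)^{(r)}=\sum_{(e_i):\,\sum e_i=r}\prod_i c_i^{e_i}(x_\alpha^\pm\otimes t^i)^{(e_i)}\in U_{\mathbb F}(\tilde{\mathfrak g})$. For $f(u)=\prod_j(1-a_ju)\in\mathbb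 F[u]$ with all $a_j\ne0$ put $\tilde f(t)=\prod_j(t-a_j)$, and let $I_{\mathbb F}^f$ be the two-sided ideal of $U_{\mathbb F}(\tilde{\mathfrak g})$ generated by all $(x_\alpha^\pm\otimes t^k\tilde f(t))^{(r)}$ with $\alpha\in R^+$, $k\in\mathbb Z$, $r>0$. **Proposition.** Let $f(u)=\prod_{j=1}^n(1-b_ju)\in\mathbb F[u]$ with $b_i^m\ne b_j^m$ for all $i\ne j$. (A factor with $b_j=0$ is equal to $1$ and is ignored in forming $\tilde f$.) Then for every $N\ge0$ the composite $$U_{\mathbb F}(\tilde{\mathfrak g}^\sigma)\xrightarrow{\ \iota\ }U_{\mathbb F}(\tilde{\mathfrak g})\longrightarrow U_{\mathbb F}(\tilde{\mathfrak g})/I_{\mathbb F}^{f^N}$$ is surjective. Consequently, let $V$ be a $U_{\mathbb F}(\tilde{\mathfrak g})$-module with $I_{\mathbb F}^{f^N}V=0$, regarded as a $U_{\mathbb F}(\tilde{\mathfrak g}^\sigma)$-module through $\iota$. If $S\subseteq V$ generates $V$ over $U_{\mathbb F}(\tilde{\mathfrak g})$, then $S$ generates $V$ over $U_{\mathbb F}(\tilde{\mathfrak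 g}^\sigma)$; and if $V$ is simple over $U_{\mathbb F}(\tilde{\mathfrak g})$, then it is simple over $U_{\mathbb F}(\tilde{\mathfrak g}^\sigma)$. -/

import Mathlib

open scoped TensorProduct LaurentPolynomial

noncomputable section

namespace TwistedHyperLoop

/-- The divided power `a ^ k / k!` in an algebra over `ℂ`. -/
def divPow {U : Type*} [Ring U] [Algebra ℂ U] (a : U) (k : ℕ) : U :=
  ((k.factorial : ℂ)⁻¹) • a ^ k

section Loop

variable {L : Type*} [LieRing L] [LieAlgebra ℂ L]

variable (L) in
/-- The loop algebra `L ⊗ ℂ[t, t⁻¹]`, with bracket `[x ⊗ f, y ⊗ g] = [x, y] ⊗ f g`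
(the Laurent polynomial is written on the left). -/
abbrev Loop : Type _ := LieAlgebra.loopAlgebra ℂ ℤ L

/-- The element `x ⊗ t ^ r` of the loop algebra. -/
def monom (x : L) (r : ℤ) : Loop L := (LaurentPolynomial.T r : ℂ[T;T⁻¹]) ⊗ₜ[ℂ] x

/-- The `ℂ`-algebra endomorphism of `ℂ[t, t⁻¹]` with `t ^ j ↦ ζ ^ j t ^ j`. -/
def scaleT (ζ : ℂˣ) : ℂ[T;T⁻¹] →ₐ[ℂ] ℂ[T;T⁻¹] :=
  AddMonoidAlgebra.lift ℂ ℂ[T;T⁻¹] ℤ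
    { toFun := fun j => ((ζ ^ (Multiplicative.toAdd j) : ℂˣ) : ℂ) •
        (LaurentPolynomial.T (Multiplicative.toAdd j) : ℂ[T;T⁻¹])
      map_one' := by simp
      map_mul' := fun a b => by
        rw [toAdd_mul, zpow_add, LaurentPolynomial.T_add, Units.val_mul, smul_mul_smul_comm] }

/-- The map `x ⊗ t ^ j ↦ ζ ^ j σ(x) ⊗ t ^ j` on the loop algebra. -/
def loopTwist (σ : L ≃ₗ⁅ℂ⁆ L) (ζ : ℂˣ) : Loop L →ₗ⁅ℂ⁆ Loop L :=
  LieAlgebra.ExtendScalars.map (scaleT ζ) (σ : L →ₗ⁅ℂ⁆ L)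

lemma loopTwist_monom (σ : L ≃ₗ⁅ℂ⁆ L) (ζ : ℂˣ) (x : L) (r : ℤ) :
    loopTwist σ ζ (monom x r) = ((ζ ^ r : ℂˣ) : ℂ) • monom (σ x) r := by
  have h : scaleT ζ (LaurentPolynomial.T r) =
      ((ζ ^ r : ℂˣ) : ℂ) • (LaurentPolynomial.T r : ℂ[T;T⁻¹]) := by
    rw [scaleT, LaurentPolynomial.T, AddMonoidAlgebra.lift_single, one_smul]
    rfl
  rw [loopTwist, monom, LieAlgebra.ExtendScalars.map_apply_tmul, h, ← TensorProduct.smul_tmul']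
  rfl

/-- The twisted loop algebra: the fixed points of `x ⊗ t ^ j ↦ ζ ^ j σ(x) ⊗ t ^ j`. -/
def twistedLoop (σ : L ≃ₗ⁅ℂ⁆ L) (ζ : ℂˣ) : LieSubalgebra ℂ (Loop L) where
  carrier := {z | loopTwist σ ζ z = z}
  add_mem' := fun {a b} ha hb => by
    have ha' : loopTwist σ ζ a = a := ha
    have hb' : loopTwist σ ζ b = b := hb
    change loopTwist σ ζ (a + b) = a + b
    rw [map_add, ha', hb']
  zero_mem' := map_zero (loopTwist σ ζ)
  smul_mem' := fun c x hx => by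
    have hx' : loopTwist σ ζ x = x := hx
    change loopTwist σ ζ (c • x) = c • x
    rw [map_smul, hx']
  lie_mem' := fun {a b} ha hb => by
    have ha' : loopTwist σ ζ a = a := ha
    have hb' : loopTwist σ ζ b = b := hb
    change loopTwist σ ζ ⁅a, b⁆ = ⁅a, b⁆
    rw [LieHom.map_lie, ha', hb']

attribute [local instance] LieRing.ofAssociativeRing

/-- The homomorphism `U(g̃^σ) → U(g̃)` of enveloping algebras induced by the inclusion. -/
def twistedToLoop (σ : L ≃ₗ⁅ℂ⁆ L) (ζ : ℂˣ) :
    UniversalEnvelopingAlgebra ℂ (twistedLoop σ ζ) →ₐ[ℂ] UniversalEnvelopingAlgebra ℂ (Loop L) :=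
  UniversalEnvelopingAlgebra.lift ℂ
    ((UniversalEnvelopingAlgebra.ι ℂ).comp (twistedLoop σ ζ).incl)

end Loop

/-- For `f = ∏ (1 - a_j u)` with all `a_j` nonzero, the polynomial `∏ (t - a_j)`. -/
def tildePoly {F : Type*} [Field F] (f : Polynomial F) : Polynomial F := f.reverse

open Polynomial in
lemma tildePoly_prod {F : Type*} [Field F] {n : ℕ} (a : Fin n → F) (ha : ∀ j, a j ≠ 0) :
    tildePoly (∏ j, (1 - C (a j) * X)) = ∏ j, (X - C (a j)) := by
  have key : ∀ c : F, c ≠ 0 → (1 - C c * X : F[X]).reverse = X - C c := by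
    intro c hc
    have h1 : (1 - C c * X : F[X]) = C 1 + C (-c) * X := by simp [sub_eq_add_neg]
    rw [h1, reverse_C_add, reverse_mul_X, reverse_C, natDegree_mul_X (by simpa using hc)]
    simp [sub_eq_add_neg]
  unfold tildePoly
  induction n with
  | zero =>
    rw [Fin.prod_univ_zero, Fin.prod_univ_zero, ← C_1, reverse_C]
  | succ n ih =>
    rw [Fin.prod_univ_succ, reverse_mul_of_domain, key _ (ha 0), ih _ (fun j => ha _),
      Fin.prod_univ_succ]

section Chevalley

open LieAlgebra LieAlgebra.IsKilling

variable {L : Type*} [LieRing L] [LieAlgebra ℂ L] [IsKilling ℂ L] [FiniteDimensional ℂ L]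
  (H : LieSubalgebra ℂ L) [H.IsCartanSubalgebra]

/-- A Chevalley basis of `L` relative to the Cartan subalgebra `H`: root vectors `x α` with
`[x α, x (-α)]` the coroot of `α` and with `[x α, x β] = ± (p + 1) x (α + β)` whenever `α + β` is a
root, `p` being the largest integer such that `β - p α` is a root. (The remaining basis elements
are the simple coroots, which need no choice.) For positive `α`, `x_α^+ = x α` and
`x_α^- = x (-α)`. -/
structure ChevalleyBasis where
  x : H.root → L
  x_mem : ∀ α : H.root, x α ∈ rootSpace H (α : LieModule.Weight ℂ H L)
  lie_neg : ∀ α β : H.root, (rootSystem H).root β = -(rootSystem H).root α →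
    ⁅x α, x β⁆ = (((rootSystem H).coroot α : H) : L)
  lie_add : ∀ α β γ : H.root,
    (rootSystem H).root γ = (rootSystem H).root α + (rootSystem H).root β →
    ⁅x α, x β⁆ = ((rootSystem H).chainBotCoeff α β + 1) • x γ ∨
    ⁅x α, x β⁆ = -(((rootSystem H).chainBotCoeff α β + 1) • x γ)

variable {H}

/-- A diagram automorphism `σ`, relative to the base `b` and the Chevalley basis `C`: an
automorphism of the root system permuting the simple roots, so that
`σ (∑ n_i α_i) = ∑ n_i α_{σ i}`, together with the automorphism of the Lie algebra that permutes
the Chevalley generators `x_i^±` accordingly. -/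
structure DiagramAut (b : (rootSystem H).Base) (C : ChevalleyBasis H) where
  rootAut : (rootSystem H).Aut
  map_simple : ∀ i ∈ b.support, rootAut.indexEquiv i ∈ b.support
  toLieEquiv : L ≃ₗ⁅ℂ⁆ L
  map_pos : ∀ i ∈ b.support, toLieEquiv (C.x i) = C.x (rootAut.indexEquiv i)
  map_neg : ∀ i ∈ b.support, ∀ i' : H.root,
    (rootSystem H).root i' = -(rootSystem H).root i →
    toLieEquiv (C.x i') = C.x (rootAut.indexEquiv i')

/-- The order `m` of a diagram automorphism. -/
def DiagramAut.order {b : (rootSystem H).Base} {C : ChevalleyBasis H} (σ : DiagramAut b C) : ℕ :=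
  orderOf σ.toLieEquiv.toLinearEquiv

/-- The action of a diagram automorphism on the roots. -/
def DiagramAut.perm {b : (rootSystem H).Base} {C : ChevalleyBasis H} (σ : DiagramAut b C) :
    H.root ≃ H.root := σ.rootAut.indexEquiv

variable {b : (rootSystem H).Base} {C : ChevalleyBasis H} (σ : DiagramAut b C)

/-- `O` is a complete set of representatives of the `σ`-orbits on the positive roots. -/
def IsOrbitReps (O : Set H.root) : Prop :=
  (∀ α ∈ O, b.IsPos α) ∧
    ∀ β : H.root, b.IsPos β → ∃! α : H.root, α ∈ O ∧ ∃ j : ℕ, σ.perm^[j] α = β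

open scoped Classical in
/-- The vector `x_{β, ε}` in the `ζ ^ ε`-eigenspace of `σ` attached to a root `β`
(`β = α` gives `x_{α, ε}^+` and `β = -α` gives `x_{α, ε}^-`).
If `σ β = β`, it is `x β` when this lies in the eigenspace and `0` otherwise. If `σ β ≠ β`, it is
`∑_{j < m} ζ ^ (-jε) σ ^ j (x β)`, multiplied by `√2` in the case that `β + σ β` is a root
(which happens exactly in type `A_{2n}`, for `β` restricting to a short root). -/
def twistedVec (ζ : ℂˣ) (β : H.root) (ε : ℤ) : L :=
  if σ.perm β = β then
    (if σ.toLieEquiv (C.x β) = ((ζ ^ ε : ℂˣ) : ℂ) • C.x β then C.x β else 0)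
  else
    (if ∃ γ : H.root, (rootSystem H).root γ =
        (rootSystem H).root β + (rootSystem H).root (σ.perm β)
      then ((√2 : ℝ) : ℂ) else 1) •
    ∑ j ∈ Finset.range σ.order, ((ζ ^ (-(j : ℤ) * ε) : ℂˣ) : ℂ) • (σ.toLieEquiv)^[j] (C.x β)

variable (C) in
/-- The divided power `(x α ⊗ t ^ r) ^ (k)` in `U(g̃)`. -/
def loopGen (α : H.root) (r : ℤ) (k : ℕ) : UniversalEnvelopingAlgebra ℂ (Loop L) :=
  divPow (UniversalEnvelopingAlgebra.ι ℂ (monom (C.x α) r)) k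

variable (C) in
/-- The integral form `U_ℤ(g̃)`: the subring of `U(g̃)` generated by the divided powers
`(x_α^± ⊗ t ^ r) ^ (k)`. -/
def loopForm : Subalgebra ℤ (UniversalEnvelopingAlgebra ℂ (Loop L)) :=
  Algebra.adjoin ℤ {u | ∃ (α : H.root) (r : ℤ) (k : ℕ), u = loopGen C α r k}

/-- The integral form `U_ℤ(g̃^σ)`: the subring of `U(g̃^σ)` generated by the divided powers
`(x_{α, -r}^± ⊗ t ^ r) ^ (k)`, where `α` runs through the set `O` of orbit representatives. -/
def twistedForm (ζ : ℂˣ) (O : Set H.root) :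
    Subalgebra ℤ (UniversalEnvelopingAlgebra ℂ (twistedLoop σ.toLieEquiv ζ)) :=
  Algebra.adjoin ℤ {u | ∃ (β : H.root) (r : ℤ) (k : ℕ) (z : twistedLoop σ.toLieEquiv ζ),
    (∃ α ∈ O, (rootSystem H).root β = (rootSystem H).root α ∨
      (rootSystem H).root β = -(rootSystem H).root α) ∧
    (z : Loop L) = monom (twistedVec σ ζ β (-r)) r ∧
    u = divPow (UniversalEnvelopingAlgebra.ι ℂ z) k}

variable (C) in
/-- The hyper loop algebra `U_F(g̃) = F ⊗ U_ℤ(g̃)`. -/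
abbrev HyperLoop (F : Type*) [Field F] : Type _ := F ⊗[ℤ] (loopForm C)

/-- The twisted hyper loop algebra `U_F(g̃^σ) = F ⊗ U_ℤ(g̃^σ)`. -/
abbrev TwistedHyper (ζ : ℂˣ) (O : Set H.root) (F : Type*) [Field F] : Type _ :=
  F ⊗[ℤ] (twistedForm σ ζ O)

/-- The ring `ℤ[ζ, √2]`. -/
def coeffRing (ζ : ℂˣ) : Subalgebra ℤ ℂ := Algebra.adjoin ℤ {(ζ : ℂ), ((√2 : ℝ) : ℂ)}

variable (C) in
/-- The multiplication map `ℤ[ζ, √2] ⊗ U_ℤ(g̃) → U(g̃)`. -/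
def coeffMul (ζ : ℂˣ) :
    (coeffRing ζ) ⊗[ℤ] (loopForm C) →ₐ[ℤ] UniversalEnvelopingAlgebra ℂ (Loop L) :=
  Algebra.TensorProduct.lift
    (((Algebra.ofId ℂ (UniversalEnvelopingAlgebra ℂ (Loop L))).restrictScalars ℤ).comp
      (coeffRing ζ).val)
    (loopForm C).val
    (fun s _ => Algebra.commutes (s : ℂ) _)

variable (C) in
/-- The reduction `ℤ[ζ, √2] ⊗ U_ℤ(g̃) → F ⊗ U_ℤ(g̃)` along a ring homomorphism
`χ : ℤ[ζ, √2] → F`. -/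
def coeffReduce {F : Type*} [Field F] {ζ : ℂˣ} (χ : coeffRing ζ →+* F) :
    (coeffRing ζ) ⊗[ℤ] (loopForm C) →ₐ[ℤ] HyperLoop C F :=
  Algebra.TensorProduct.map χ.toIntAlgHom (AlgHom.id ℤ (loopForm C))

/-- `φ : U_F(g̃^σ) → U_F(g̃)` is the homomorphism induced by the inclusion of `U(g̃^σ)` in `U(g̃)`:
every `u ∈ U_ℤ(g̃^σ)` becomes in `U(g̃)` a `ℤ[ζ, √2]`-linear combination `∑ s_i v_i` of elements
`v_i ∈ U_ℤ(g̃)`, and `φ (1 ⊗ u) = ∑ χ(s_i) ⊗ v_i`. -/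
def IsInducedByInclusion {F : Type*} [Field F] {ζ : ℂˣ} {O : Set H.root} (χ : coeffRing ζ →+* F)
    (φ : TwistedHyper σ ζ O F →ₐ[F] HyperLoop C F) : Prop :=
  ∀ u : twistedForm σ ζ O, ∃ w : (coeffRing ζ) ⊗[ℤ] (loopForm C),
    coeffMul C ζ w = twistedToLoop σ.toLieEquiv ζ u ∧
    φ ((1 : F) ⊗ₜ[ℤ] u) = coeffReduce C χ w

section Ideal

variable (C) {F : Type*} [Field F]

/-- The divided power `(x α ⊗ t ^ r) ^ (k)` as an element of `U_F(g̃)`. -/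
def hyperGen (F : Type*) [Field F] (α : H.root) (r : ℤ) (k : ℕ) : HyperLoop C F :=
  (1 : F) ⊗ₜ[ℤ] (⟨loopGen C α r k, Algebra.subset_adjoin ⟨α, r, k, rfl⟩⟩ : loopForm C)

/-- The divided power `(x α ⊗ p) ^ (r)` in `U_F(g̃)` of a Laurent polynomial `p = ∑ c_i t ^ i` over
`F`, given by the multinomial expansion for the commuting elements `c_i (x α ⊗ t ^ i)`:
`∑ ∏_i c_i ^ (e_i) (x α ⊗ t ^ i) ^ (e_i)`, over the families `(e_i)` with `∑ e_i = r`. -/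
def hyperDivPow (α : H.root) (p : F[T;T⁻¹]) (r : ℕ) : HyperLoop C F :=
  ∑ e ∈ p.coeff.support.finsuppAntidiag r,
    ((p.coeff.support.sort (· ≤ ·)).map
      (fun i => p.coeff i ^ e i • hyperGen C F α i (e i))).prod

end Ideal

variable (C) in
/-- The two-sided ideal `I_F^f` of `U_F(g̃)` generated by the elements
`(x_α^± ⊗ t ^ k f̃(t)) ^ (r)` with `k ∈ ℤ` and `r > 0`. -/
def twistIdeal {F : Type*} [Field F] (f : Polynomial F) : TwoSidedIdeal (HyperLoop C F) :=
  TwoSidedIdeal.span {u | ∃ (α : H.root) (k : ℤ) (r : ℕ), 0 < r ∧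
    u = hyperDivPow C α (LaurentPolynomial.T k * Polynomial.toLaurent (tildePoly f)) r}

end Chevalley

end TwistedHyperLoop

end

/-! Let `Exp(x_α ⊗ p)` denote the generating series of the divided powers `(x_α ⊗ p)^(k)`. The map
`p ↦ Exp(x_α ⊗ p)` turns sums into products of invertible series (`hyperSeries_add`). So, for a
subalgebra `A` of `U_F(g̃)`, the `p` whose series has all its coefficients in `A` form a subspace
(`divPowSubmodule`). Surjectivity amounts to this subspace being everything for each root, where `A`
is the image of `ι` plus the ideal (`divPowSubmodule_eq_top`).

Existence of `ι`: `σ` permutes the root vectors up to sign, so `x_{β,-r} ⊗ t^r` is a combination of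
root vectors along one orbit. These commute or, when `β + σβ` is a root, generate a Heisenberg
algebra. In either case the exponential factors into exponentials of single root vectors with
coefficients in `ℤ[ζ, √2]` (`exists_isLift`); the normalization by `√2` cancels the `1/2` in the
Heisenberg correction. As `ℤ[ζ, √2] ⊗ U_ℤ(g̃) → U(g̃)` is injective (`coeffMul_injective`), such
lifts are unique, which gives existence, multiplicativity and uniqueness of `ι`.

Surjectivity: let `h` be the Laurent polynomial of `f^N`, and `ω` the image of `ζ`, still a
primitive `m`-th root of unity. For every `p`, `A` contains the coefficients of `Exp(x_β ⊗ p) Exp(±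
x_{σβ} ⊗ p(ωt)) ⋯`. Since the `b_j^m` are distinct, `h` is coprime to `h(ω^j t)` for `0 < j < m`, so
any `q` is congruent mod `h` to some `p` with every `p(ω^j t)` divisible by `h`
(`exists_interpolation`). Multiples of `h` belong to the subspaces, so all factors but the first can
be removed, and `q` belongs to the subspace of `β`. With that factor gone, the next root of the
orbit is reached. For a fixed root only the monomials in one class of exponents mod `m` are given,
and averaging over `t ↦ ω^j t` leads back to the same interpolation (`eq_top_of_T_mem`). Fixed roots
are settled before the Heisenberg case, whose correction terms belong to the fixed root `β + σβ`.

The statements on modules follow because each element of `U_F(g̃)` acts on `V` as some element of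
the image of `ι`. -/

open scoped TensorProduct LaurentPolynomial

noncomputable section

namespace TwistedHyperLoop

/-! ### Power series over a noncommutative ring. -/

section Series

open PowerSeries

variable {R : Type*} [Ring R]

/-- The substitution `X ↦ X ^ 2` in power series over a possibly noncommutative ring. -/
def sqSubst (f : R⟦X⟧) : R⟦X⟧ :=
  PowerSeries.mk fun n => if Even n then coeff (n / 2) f else 0

lemma coeff_sqSubst (f : R⟦X⟧) (n : ℕ) :
    coeff n (sqSubst f) = if Even n then coeff (n / 2) f else 0 := coeff_mk _ _

lemma coeff_sqSubst_mul (f g : R⟦X⟧) (n : ℕ) :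
    coeff n (sqSubst f * g) =
      ∑ c ∈ Finset.range (n / 2 + 1), coeff c f * coeff (n - 2 * c) g := by
  rw [coeff_mul, Finset.Nat.sum_antidiagonal_eq_sum_range_succ_mk]
  symm
  refine Finset.sum_of_injOn (fun c => 2 * c) (fun _ _ _ _ h => by simpa using h) ?_ ?_ ?_
  · intro c hc; simp at hc ⊢; omega
  · intro m hm hm'
    have : ¬ Even m := by
      rintro ⟨c, rfl⟩
      exact hm' ⟨c, by simp at hm ⊢; omega, by simp; omega⟩
    simp [coeff_sqSubst, this]
  · intro c _; simp [coeff_sqSubst]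

lemma sqSubst_mul (f g : R⟦X⟧) : sqSubst (f * g) = sqSubst f * sqSubst g := by
  ext n
  rw [coeff_sqSubst_mul, coeff_sqSubst]
  split_ifs with h
  · obtain ⟨k, rfl⟩ := h
    rw [show (k + k) / 2 = k by omega, coeff_mul,
      Finset.Nat.sum_antidiagonal_eq_sum_range_succ_mk]
    refine Finset.sum_congr rfl fun c hc => ?_
    simp at hc
    rw [coeff_sqSubst, if_pos ⟨k - c, by omega⟩, show (k + k - 2 * c) / 2 = k - c by omega]
  · refine (Finset.sum_eq_zero fun c hc => ?_).symm
    simp at hc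
    rw [coeff_sqSubst, if_neg, mul_zero]
    rintro ⟨d, hd⟩
    exact h ⟨c + d, by omega⟩

lemma sqSubst_one : sqSubst (1 : R⟦X⟧) = 1 := by
  ext n
  rw [coeff_sqSubst, coeff_one, coeff_one]
  split_ifs <;> first | rfl | (exfalso; grind)

lemma map_sqSubst {S : Type*} [Ring S] (φ : R →+* S) (f : R⟦X⟧) :
    PowerSeries.map φ (sqSubst f) = sqSubst (PowerSeries.map φ f) := by
  ext n
  simp only [coeff_map, coeff_sqSubst]
  split_ifs <;> simp

lemma commute_of_coeff {f g : R⟦X⟧} (h : ∀ i j, Commute (coeff i f) (coeff j g)) :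
    Commute f g := by
  ext n
  rw [coeff_mul, coeff_mul, ← Finset.Nat.sum_antidiagonal_swap]
  exact Finset.sum_congr rfl fun p _ => h _ _

lemma commute_sqSubst {f g : R⟦X⟧} (h : ∀ i j, Commute (coeff i f) (coeff j g)) :
    Commute f (sqSubst g) := by
  refine commute_of_coeff fun i j => ?_
  rw [coeff_sqSubst]
  split_ifs
  · exact h _ _
  · exact Commute.zero_right _

/-- The formal derivative of a power series over a possibly noncommutative ring. -/
def formalDeriv (f : R⟦X⟧) : R⟦X⟧ :=
  PowerSeries.mk fun n => (n + 1 : R) * coeff (n + 1) f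

lemma formalDeriv_mul (f g : R⟦X⟧) :
    formalDeriv (f * g) = formalDeriv f * g + f * formalDeriv g := by
  ext n
  simp only [formalDeriv, coeff_mk, map_add, coeff_mul]
  have h1 : ∑ p ∈ Finset.HasAntidiagonal.antidiagonal (n + 1), ((p.1 : R) * coeff p.1 f) * coeff p.2 g =
      ∑ p ∈ Finset.HasAntidiagonal.antidiagonal n, ((p.1 + 1 : R) * coeff (p.1 + 1) f) * coeff p.2 g := by
    rw [Finset.Nat.antidiagonal_succ]
    simp
  have h2 : ∑ p ∈ Finset.HasAntidiagonal.antidiagonal (n + 1), coeff p.1 f * ((p.2 : R) * coeff p.2 g) =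
      ∑ p ∈ Finset.HasAntidiagonal.antidiagonal n, coeff p.1 f * ((p.2 + 1 : R) * coeff (p.2 + 1) g) := by
    rw [Finset.Nat.antidiagonal_succ']
    simp
  rw [← h1, ← h2, ← Finset.sum_add_distrib, Finset.mul_sum]
  refine Finset.sum_congr rfl fun p hp => ?_
  rw [Finset.HasAntidiagonal.mem_antidiagonal] at hp
  rw [← mul_assoc (coeff p.1 f), ← (Nat.cast_commute p.2 (coeff p.1 f)).eq, mul_assoc, mul_assoc,
    ← add_mul]
  congr 1
  exact_mod_cast congrArg (Nat.cast : ℕ → R) hp.symm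

/-- The chain rule for `X ↦ X ^ 2`. -/
lemma formalDeriv_sqSubst (f : R⟦X⟧) :
    formalDeriv (sqSubst f) = PowerSeries.X * (2 * sqSubst (formalDeriv f)) := by
  ext n
  rcases n with _ | n
  · simp [formalDeriv, coeff_sqSubst]
  · rw [coeff_succ_X_mul, two_mul, map_add]
    simp only [formalDeriv, coeff_mk, coeff_sqSubst]
    by_cases h : Even n
    · obtain ⟨k, rfl⟩ := h
      rw [if_pos ⟨k + 1, by omega⟩, if_pos ⟨k, rfl⟩, show (k + k + 1 + 1) / 2 = k + 1 by omega,
        show (k + k) / 2 = k by omega, ← add_mul]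
      congr 1
      push_cast
      abel
    · rw [if_neg (by grind), if_neg h]
      simp

end Series

/-! ### Exponential series and divided powers over `ℂ`. -/

section DivPow

open PowerSeries

variable {U : Type*} [Ring U] [Algebra ℂ U]

lemma divPow_zero (a : U) : divPow a 0 = 1 := by simp [divPow]

lemma divPow_one (a : U) : divPow a 1 = a := by simp [divPow]

lemma succ_mul_divPow_succ (a : U) (k : ℕ) :
    ((k : U) + 1) * divPow a (k + 1) = a * divPow a k := by
  have h : ((k : U) + 1) = algebraMap ℂ U ((k : ℂ) + 1) := by simp
  rw [h, ← Algebra.smul_def, divPow, divPow, smul_smul, Nat.factorial_succ, pow_succ',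
    mul_smul_comm]
  congr 1
  push_cast
  field_simp

lemma divPow_smul (c : ℂ) (a : U) (k : ℕ) : divPow (c • a) k = c ^ k • divPow a k := by
  rw [divPow, divPow, smul_pow, smul_comm]

lemma divPow_mul_divPow (a : U) (i j : ℕ) :
    divPow a i * divPow a j = ((i + j).choose i) • divPow a (i + j) := by
  rw [divPow, divPow, divPow, smul_mul_smul_comm, ← pow_add, ← Nat.cast_smul_eq_nsmul ℂ, smul_smul]
  congr 1
  rw [Nat.cast_add_choose]
  have := Nat.factorial_ne_zero (i + j)
  field_simp

lemma divPow_zero_left (k : ℕ) (hk : k ≠ 0) : divPow (0 : U) k = 0 := by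
  simp [divPow, zero_pow hk]

lemma map_divPow {V : Type*} [Ring V] [Algebra ℂ V] (f : U →ₐ[ℂ] V) (a : U) (k : ℕ) :
    f (divPow a k) = divPow (f a) k := by
  simp [divPow]

lemma commute_divPow {a b : U} (h : Commute a b) (i j : ℕ) :
    Commute (divPow a i) (divPow b j) :=
  ((h.pow_pow i j).smul_left _).smul_right _

/-- The power series `∑ a ^ (k) X ^ k`. -/
def expSeries (a : U) : U⟦X⟧ := PowerSeries.mk (divPow a)

@[simp] lemma coeff_expSeries (a : U) (k : ℕ) : coeff k (expSeries a) = divPow a k := coeff_mk _ _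

lemma formalDeriv_expSeries (a : U) :
    formalDeriv (expSeries a) = PowerSeries.C a * expSeries a := by
  ext k
  simp [formalDeriv, coeff_C_mul, succ_mul_divPow_succ]

/-- The equation `f' = a f` determines every coefficient from the constant one, because `k + 1` is
invertible in `ℂ`. The product formulas for exponentials are obtained by checking this equation. -/
lemma eq_expSeries {a : U} {f : U⟦X⟧} (h0 : coeff 0 f = 1)
    (h : formalDeriv f = PowerSeries.C a * f) : f = expSeries a := by
  ext k
  induction k with
  | zero => simp [h0, divPow_zero]
  | succ k ih =>
    have h1 : ((k : U) + 1) * coeff (k + 1) f = a * coeff k f := by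
      simpa [formalDeriv, coeff_C_mul] using congrArg (coeff k) h
    rw [coeff_expSeries] at ih ⊢
    rw [ih, ← succ_mul_divPow_succ] at h1
    have h2 : ((k : U) + 1) = algebraMap ℂ U ((k : ℂ) + 1) := by simp
    rw [h2, ← Algebra.smul_def, ← Algebra.smul_def] at h1
    have h3 : (k : ℂ) + 1 ≠ 0 := by exact_mod_cast Nat.succ_ne_zero k
    exact smul_right_injective U h3 h1

lemma expSeries_add {a b : U} (h : Commute a b) :
    expSeries (a + b) = expSeries a * expSeries b := by
  symm
  refine eq_expSeries (by simp [coeff_mul, divPow_zero]) ?_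
  have hc : Commute (expSeries a) (PowerSeries.C b) := by
    ext k
    rw [coeff_mul_C, coeff_C_mul, coeff_expSeries]
    simpa [divPow_one] using (commute_divPow h k 1).eq
  rw [formalDeriv_mul, formalDeriv_expSeries, formalDeriv_expSeries, ← mul_assoc, hc.eq, map_add]
  noncomm_ring

/-- Conjugation by `exp(aX)` sends `b` to `b + Xz`; the higher commutators vanish because `z`
commutes with `a`. -/
lemma expSeries_mul_C {a b z : U} (h : a * b = b * a + z) (hz : Commute a z) :
    expSeries a * PowerSeries.C b =
      (PowerSeries.C b + PowerSeries.X * PowerSeries.C z) * expSeries a := by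
  have key : ∀ k : ℕ, divPow a (k + 1) * b = b * divPow a (k + 1) + z * divPow a k := by
    intro k
    have hp : ∀ k : ℕ, a ^ (k + 1) * b = b * a ^ (k + 1) + ((k : ℂ) + 1) • (z * a ^ k) := by
      intro k
      induction k with
      | zero => simp [h]
      | succ k ih =>
        rw [pow_succ', mul_assoc, ih, mul_add, ← mul_assoc, h, add_mul, mul_smul_comm, ← mul_assoc,
          hz.eq, mul_assoc z a, ← pow_succ', mul_assoc b a, ← pow_succ', add_assoc]
        congr 1
        push_cast
        module
    rw [divPow, divPow, smul_mul_assoc, hp, smul_add, mul_smul_comm, mul_smul_comm, smul_smul]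
    congr 2
    rw [Nat.factorial_succ]
    push_cast
    have h3 : (k : ℂ) + 1 ≠ 0 := by exact_mod_cast Nat.succ_ne_zero k
    field_simp
  ext k
  rw [coeff_mul_C, add_mul, map_add, coeff_C_mul, mul_assoc]
  rcases k with _ | k
  · simp [divPow_zero]
  · rw [coeff_succ_X_mul, coeff_C_mul]
    simpa using key k

/-- The exponential of a sum in a Heisenberg algebra. -/
lemma expSeries_add_of_heisenberg {a b w : U} (h : a * b = b * a + (-2 : ℂ) • w)
    (ha : Commute a w) (hb : Commute b w) :
    expSeries (a + b) = expSeries a * expSeries b * sqSubst (expSeries w) := by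
  -- The product satisfies `f' = (a + b) f`: moving `b` to the left past `exp(aX)` produces the
  -- error `-2Xw`, and differentiating the last factor contributes `2Xw`, which cancels it.
  symm
  refine eq_expSeries (by simp [coeff_mul, divPow_zero, coeff_sqSubst]) ?_
  have h1 := expSeries_mul_C h (ha.smul_right (-2 : ℂ))
  have hC : ∀ {x : U}, Commute x w → Commute (expSeries x) (PowerSeries.C w) := by
    intro x hx
    ext k
    rw [coeff_mul_C, coeff_C_mul, coeff_expSeries]
    simpa [divPow_one] using (commute_divPow hx k 1).eq
  have hX : ∀ f : U⟦X⟧, f * PowerSeries.X = PowerSeries.X * f := fun f => (commute_X f).eq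
  have h2 : (PowerSeries.C ((-2 : ℂ) • w) : U⟦X⟧) = -(2 * PowerSeries.C w) := by
    rw [neg_smul, map_neg, two_smul, map_add, two_mul]
  have hsq : sqSubst (PowerSeries.C w * expSeries w) =
      PowerSeries.C w * sqSubst (expSeries w) := by
    ext n
    simp only [coeff_sqSubst, coeff_C_mul]
    split_ifs <;> simp
  set A := expSeries a
  set B := expSeries b
  set G := sqSubst (expSeries w)
  have hA : A * PowerSeries.C w = PowerSeries.C w * A := (hC ha).eq
  have hB : B * PowerSeries.C w = PowerSeries.C w * B := (hC hb).eq
  have e1 : A * B * (PowerSeries.X * (2 * (PowerSeries.C w * G))) =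
      PowerSeries.X * (2 * (PowerSeries.C w * (A * B * G))) := by
    rw [← mul_assoc (A * B), hX, mul_assoc, two_mul, two_mul, mul_add]
    have : A * B * (PowerSeries.C w * G) = PowerSeries.C w * (A * B * G) := by
      rw [← mul_assoc, mul_assoc A, hB, ← mul_assoc A, hA, mul_assoc, mul_assoc, mul_assoc]
    rw [this]
  have e2 : A * (PowerSeries.C b * B) =
      (PowerSeries.C b + PowerSeries.X * -(2 * PowerSeries.C w)) * (A * B) := by
    rw [← mul_assoc, h1, h2, mul_assoc]
  rw [formalDeriv_mul, formalDeriv_mul, formalDeriv_expSeries, formalDeriv_expSeries,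
    formalDeriv_sqSubst, formalDeriv_expSeries, hsq, e1, e2, map_add]
  noncomm_ring

/-- Conjugation by `exp(aX)` sends `b^j` to `(b + Xz)^j`. Expand by the binomial theorem, compare
coefficients of `X^i` and divide by `j!`. -/
lemma divPow_mul_divPow_of_heisenberg {a b z : U} (h : a * b = b * a + z)
    (ha : Commute a z) (hb : Commute b z) (i j : ℕ) :
    divPow a i * divPow b j = ∑ p ∈ Finset.HasAntidiagonal.antidiagonal j,
      if p.1 ≤ i then divPow z p.1 * divPow b p.2 * divPow a (i - p.1) else 0 := by
  have h1 : SemiconjBy (expSeries a) (PowerSeries.C b)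
      (PowerSeries.X * PowerSeries.C z + PowerSeries.C b) := by
    rw [SemiconjBy, expSeries_mul_C h ha, add_comm]
  have h2 := h1.pow_right j
  have hc : Commute (PowerSeries.X * PowerSeries.C z) (PowerSeries.C b : U⟦X⟧) := by
    refine Commute.mul_left (commute_X _).symm ?_
    rw [Commute, SemiconjBy, ← map_mul, ← map_mul, hb.eq]
  rw [hc.add_pow'] at h2
  have h3 := congrArg (coeff i) h2.eq
  rw [← map_pow, coeff_mul_C, coeff_expSeries, Finset.sum_mul, map_sum] at h3
  have h4 : divPow a i * divPow b j = ((j.factorial : ℂ)⁻¹) • (divPow a i * b ^ j) := by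
    rw [divPow, divPow, mul_smul_comm]
  rw [h4, h3, Finset.smul_sum]
  refine Finset.sum_congr rfl fun p hp => ?_
  rw [Finset.HasAntidiagonal.mem_antidiagonal] at hp
  rw [(commute_X (PowerSeries.C z : U⟦X⟧)).symm.mul_pow, ← map_pow, ← map_pow, smul_mul_assoc,
    map_nsmul, mul_assoc, mul_assoc, coeff_X_pow_mul']
  split_ifs with hi
  · rw [coeff_C_mul, coeff_C_mul, coeff_expSeries, ← Nat.cast_smul_eq_nsmul ℂ]
    simp only [divPow, smul_mul_assoc, mul_smul_comm, smul_smul, mul_assoc]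
    congr 1
    subst hp
    rw [Nat.cast_add_choose]
    have := Nat.factorial_ne_zero (p.1 + p.2)
    field_simp
  · simp

end DivPow

section Exchange

open PowerSeries

/-- With `j = c + d`, the degree `i + j` equals `2c + d + (i - c)`, so the index of `z` counts
twice. The families are arbitrary because over `F` divided powers are not powers divided by
factorials. -/
lemma mk_mul_mk_of_exchange {R : Type*} [Ring R] {a b z : ℕ → R}
    (h : ∀ i j, a i * b j = ∑ p ∈ Finset.HasAntidiagonal.antidiagonal j,
      if p.1 ≤ i then z p.1 * b p.2 * a (i - p.1) else 0) :
    PowerSeries.mk a * PowerSeries.mk b =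
      sqSubst (PowerSeries.mk z) * (PowerSeries.mk b * PowerSeries.mk a) := by
  ext n
  rw [coeff_sqSubst_mul, coeff_mul]
  simp only [coeff_mul, coeff_mk, h, Finset.mul_sum]
  simp only [← Finset.sum_filter]
  rw [Finset.sum_sigma', Finset.sum_sigma']
  refine Finset.sum_bij' (fun x _ => ⟨x.2.1, (x.2.2, x.1.1 - x.2.1)⟩)
    (fun y _ => ⟨(y.2.2 + y.1, y.2.1 + y.1), (y.1, y.2.1)⟩) ?_ ?_ ?_ ?_ ?_
  · rintro ⟨⟨i, j⟩, ⟨c, d⟩⟩ hx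
    simp at hx ⊢
    omega
  · rintro ⟨c, ⟨d, f⟩⟩ hy
    simp at hy ⊢
    omega
  · rintro ⟨⟨i, j⟩, ⟨c, d⟩⟩ hx
    simp at hx ⊢
    omega
  · rintro ⟨c, ⟨d, f⟩⟩ hy
    simp at hy ⊢
  · rintro ⟨⟨i, j⟩, ⟨c, d⟩⟩ hx
    simp [mul_assoc]

end Exchange

/-! ### The action of a diagram automorphism on roots and root vectors. -/

section Roots

open LieAlgebra LieAlgebra.IsKilling Set

variable {L : Type*} [LieRing L] [LieAlgebra ℂ L] [IsKilling ℂ L] [FiniteDimensional ℂ L]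
  {H : LieSubalgebra ℂ L} [H.IsCartanSubalgebra]
  {b : (rootSystem H).Base} {C : ChevalleyBasis H} (σ : DiagramAut b C)

lemma root_reflectionPerm_self (α : H.root) :
    (rootSystem H).root ((rootSystem H).reflectionPerm α α) = -(rootSystem H).root α := by
  rw [RootPairing.root_reflectionPerm, RootPairing.reflection_apply_self]

lemma exists_neg_root (α : H.root) : ∃ β : H.root, (rootSystem H).root β = -(rootSystem H).root α :=
  ⟨(rootSystem H).reflectionPerm α α, root_reflectionPerm_self α⟩

lemma height_neg {α β : H.root} (h : (rootSystem H).root β = -(rootSystem H).root α) :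
    b.height β = -b.height α := by
  let := (rootSystem H).indexNeg
  have : β = -α := (rootSystem H).root.injective (h.trans (root_reflectionPerm_self α).symm)
  rw [this, b.height_reflectionPerm_self]

namespace DiagramAut

lemma root_perm (α : H.root) :
    (rootSystem H).root (σ.perm α) = σ.rootAut.weightMap ((rootSystem H).root α) :=
  (RootPairing.Hom.root_weightMap_apply _ _ α σ.rootAut.toHom).symm

lemma weightMap_injective : Function.Injective σ.rootAut.weightMap :=
  σ.rootAut.bijective_weightMap.injective

lemma root_perm_add {α β γ : H.root}
    (h : (rootSystem H).root γ = (rootSystem H).root α + (rootSystem H).root β) :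
    (rootSystem H).root (σ.perm γ) =
      (rootSystem H).root (σ.perm α) + (rootSystem H).root (σ.perm β) := by
  simp only [root_perm, h, map_add]

lemma root_perm_neg {α β : H.root}
    (h : (rootSystem H).root β = -(rootSystem H).root α) :
    (rootSystem H).root (σ.perm β) = -(rootSystem H).root (σ.perm α) := by
  rw [root_perm, root_perm, h, LinearMap.map_neg]

lemma pairing_perm (α β : H.root) :
    (rootSystem H).pairing (σ.perm α) (σ.perm β) = (rootSystem H).pairing α β := by
  rw [← RootPairing.root_coroot_eq_pairing, root_perm]
  have h := RootPairing.Hom.weight_coweight_transpose_apply _ _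
    ((rootSystem H).coroot (σ.perm β)) σ.rootAut.toHom
  rw [RootPairing.Hom.coroot_coweightMap_apply] at h
  have h2 := LinearMap.congr_fun h ((rootSystem H).root α)
  have h3 : σ.rootAut.indexEquiv.symm (σ.perm β) = β := σ.rootAut.indexEquiv.symm_apply_apply β
  rw [h3] at h2
  exact h2

lemma pairingIn_perm (α β : H.root) :
    (rootSystem H).pairingIn ℤ (σ.perm α) (σ.perm β) = (rootSystem H).pairingIn ℤ α β := by
  have h := pairing_perm σ α β
  rw [← (rootSystem H).algebraMap_pairingIn ℤ, ← (rootSystem H).algebraMap_pairingIn ℤ] at h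
  simpa using h

lemma root_mem_range_iff (x : Module.Dual ℂ H) :
    σ.rootAut.weightMap x ∈ range (rootSystem H).root ↔ x ∈ range (rootSystem H).root := by
  constructor
  · rintro ⟨β, hβ⟩
    obtain ⟨α, rfl⟩ := σ.perm.surjective β
    rw [root_perm] at hβ
    exact ⟨α, σ.weightMap_injective hβ⟩
  · rintro ⟨α, rfl⟩
    exact ⟨σ.perm α, root_perm σ α⟩

/-- Root strings depend only on which vectors are roots, and `weightMap` preserves this. -/
lemma chainBotCoeff_perm (α β : H.root) :
    (rootSystem H).chainBotCoeff (σ.perm α) (σ.perm β) = (rootSystem H).chainBotCoeff α β := by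
  have hli : LinearIndependent ℂ ![(rootSystem H).root (σ.perm α), (rootSystem H).root (σ.perm β)] ↔
      LinearIndependent ℂ ![(rootSystem H).root α, (rootSystem H).root β] := by
    have := LinearMap.linearIndependent_iff (v := ![(rootSystem H).root α, (rootSystem H).root β])
      σ.rootAut.weightMap (LinearMap.ker_eq_bot.mpr σ.weightMap_injective)
    rw [← this, root_perm, root_perm]
    congr! 1
    ext i
    fin_cases i <;> rfl
  by_cases h : LinearIndependent ℂ ![(rootSystem H).root α, (rootSystem H).root β]
  · refine eq_of_forall_le_iff fun n => ?_
    rw [← RootPairing.root_sub_nsmul_mem_range_iff_le_chainBotCoeff h,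
      ← RootPairing.root_sub_nsmul_mem_range_iff_le_chainBotCoeff (hli.mpr h),
      root_perm, root_perm, ← map_nsmul, ← map_sub, root_mem_range_iff]
  · rw [RootPairing.chainBotCoeff_of_not_linearIndependent h,
      RootPairing.chainBotCoeff_of_not_linearIndependent (mt hli.mp h)]

/-- Simple roots go to simple roots. Invariance of the height is what later excludes that `α + σ^j
α` vanishes or that `σα - α` is a root. -/
lemma height_perm (α : H.root) : b.height (σ.perm α) = b.height α := by
  refine b.induction_add α (p := fun α => b.height (σ.perm α) = b.height α) ?_ ?_ ?_
  · intro i hi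
    have h := root_reflectionPerm_self i
    rw [height_neg h, height_neg (σ.root_perm_neg h), hi]
  · intro i hi
    rw [b.height_one_of_mem_support hi, show b.height (σ.perm i) = 1 from b.height_one_of_mem_support (σ.map_simple i hi)]
  · intro i j k h hi hj
    rw [b.height_add h, b.height_add (σ.root_perm_add h), hi,
      b.height_one_of_mem_support hj,
      show b.height (σ.perm j) = 1 from b.height_one_of_mem_support (σ.map_simple j hj)]

lemma height_iterate_perm (α : H.root) (j : ℕ) : b.height (σ.perm^[j] α) = b.height α := by
  induction j with
  | zero => rfl
  | succ j ih => rw [Function.iterate_succ_apply', height_perm, ih]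

end DiagramAut

lemma chevalley_ne_zero (C : ChevalleyBasis H) (α : H.root) : C.x α ≠ 0 := by
  intro h
  obtain ⟨β, hβ⟩ := exists_neg_root α
  have h1 := C.lie_neg α β hβ
  rw [h, zero_lie] at h1
  exact (rootSystem H).ne_zero' (i := α) (by exact_mod_cast h1.symm)

/-- The bracket lies in the weight space of `α + β`; if it were nonzero, `α + β` would be a nonzero
weight, hence a root. -/
lemma chevalley_lie_eq_zero (C : ChevalleyBasis H) {α β : H.root}
    (h0 : (rootSystem H).root α + (rootSystem H).root β ≠ 0)
    (h : (rootSystem H).root α + (rootSystem H).root β ∉ range (rootSystem H).root) :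
    ⁅C.x α, C.x β⁆ = 0 := by
  have h1 := lie_mem_genWeightSpace_of_mem_genWeightSpace (C.x_mem α) (C.x_mem β)
  by_contra hne
  have hbot : rootSpace H ((α : LieModule.Weight ℂ H L) + (β : LieModule.Weight ℂ H L) : H → ℂ) ≠ ⊥ := by
    intro hb
    have h2 : ⁅C.x α, C.x β⁆ ∈ (⊥ : LieSubmodule ℂ H L) := hb ▸ h1
    exact hne (by simpa using h2)
  let γ : LieModule.Weight ℂ H L := ⟨_, hbot⟩
  have hγ : γ.toLinear = (rootSystem H).root α + (rootSystem H).root β := by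
    ext x; rfl
  have hγ0 : γ.IsNonZero := by
    intro hz
    apply h0
    rw [← hγ]
    ext x
    exact congrFun hz x
  refine h ⟨⟨γ, by simpa using hγ0⟩, ?_⟩
  rw [← hγ]; rfl

namespace DiagramAut

/-- Apply `σ` to `[x_α, x_β] = ±(p + 1) x_γ`. The integer `p` is the same for `σα, σβ`
(`chainBotCoeff_perm`), so `p + 1` cancels and only signs remain. -/
lemma sign_step {α β γ : H.root}
    (h : (rootSystem H).root γ = (rootSystem H).root α + (rootSystem H).root β)
    (hα : ∃ s : ℤˣ, σ.toLieEquiv (C.x α) = (s : ℤ) • C.x (σ.perm α))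
    (hβ : ∃ s : ℤˣ, σ.toLieEquiv (C.x β) = (s : ℤ) • C.x (σ.perm β)) :
    ∃ s : ℤˣ, σ.toLieEquiv (C.x γ) = (s : ℤ) • C.x (σ.perm γ) := by
  obtain ⟨s, hs⟩ := hα
  obtain ⟨t, ht⟩ := hβ
  have key : ∀ {δ ε ζ : H.root},
      (rootSystem H).root ζ = (rootSystem H).root δ + (rootSystem H).root ε →
      ∃ u : ℤˣ, ⁅C.x δ, C.x ε⁆ =
        (u : ℤ) • (((rootSystem H).chainBotCoeff δ ε + 1 : ℕ) : ℂ) • C.x ζ := by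
    intro δ ε ζ hz
    rcases C.lie_add δ ε ζ hz with h1 | h1
    · exact ⟨1, by rw [h1, Nat.cast_smul_eq_nsmul]; simp⟩
    · exact ⟨-1, by rw [h1, Nat.cast_smul_eq_nsmul]; simp⟩
  obtain ⟨u, hu⟩ := key h
  obtain ⟨v, hv⟩ := key (σ.root_perm_add h)
  rw [chainBotCoeff_perm] at hv
  set n : ℂ := (((rootSystem H).chainBotCoeff α β + 1 : ℕ) : ℂ)
  have hn : n ≠ 0 := Nat.cast_ne_zero.mpr (Nat.succ_ne_zero _)
  have h1 := congrArg σ.toLieEquiv hu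
  rw [LieEquiv.map_lie, hs, ht, zsmul_lie, lie_zsmul, hv, map_zsmul,
    show σ.toLieEquiv (n • C.x γ) = n • σ.toLieEquiv (C.x γ) from
      σ.toLieEquiv.toLinearEquiv.map_smul n _] at h1
  refine ⟨u * (s * (t * v)), ?_⟩
  have h2 : n • σ.toLieEquiv (C.x γ) = n • (((u * (s * (t * v)) : ℤˣ) : ℤ) • C.x (σ.perm γ)) := by
    have hu2 : (u : ℤ) * u = 1 := by
      rw [← Units.val_mul, Int.units_mul_self, Units.val_one]
    calc n • σ.toLieEquiv (C.x γ) = ((u : ℤ) * u) • n • σ.toLieEquiv (C.x γ) := by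
          rw [hu2, one_smul]
      _ = (u : ℤ) • ((s : ℤ) • (t : ℤ) • (v : ℤ) • n • C.x (σ.perm γ)) := by
          rw [mul_smul, ← h1]
      _ = _ := by
          simp only [Units.val_mul]
          module
  exact smul_right_injective L hn h2

/-- A diagram automorphism permutes the root vectors of the Chevalley basis up to signs. -/
lemma exists_sign (α : H.root) :
    ∃ s : ℤˣ, σ.toLieEquiv (C.x α) = (s : ℤ) • C.x (σ.perm α) := by
  have key : ∀ {α : H.root}, b.IsPos α →
      (∃ s : ℤˣ, σ.toLieEquiv (C.x α) = (s : ℤ) • C.x (σ.perm α)) ∧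
      ∀ α' : H.root, (rootSystem H).root α' = -(rootSystem H).root α →
        ∃ s : ℤˣ, σ.toLieEquiv (C.x α') = (s : ℤ) • C.x (σ.perm α') := by
    intro α hα
    have hs : ∀ i ∈ b.support, (∃ s : ℤˣ, σ.toLieEquiv (C.x i) = (s : ℤ) • C.x (σ.perm i)) ∧
      ∀ α' : H.root, (rootSystem H).root α' = -(rootSystem H).root i →
        ∃ s : ℤˣ, σ.toLieEquiv (C.x α') = (s : ℤ) • C.x (σ.perm α') := fun i hi =>
      ⟨⟨1, by simpa using! σ.map_pos i hi⟩,
        fun i' hi' => ⟨1, by simpa using! σ.map_neg i hi i' hi'⟩⟩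
    refine hα.induction_on_add hs ?_
    intro i j k hk hi hj
    refine ⟨σ.sign_step hk hi.1 (hs j hj).1, fun k' hk' => ?_⟩
    obtain ⟨i', hi'⟩ := exists_neg_root i
    obtain ⟨j', hj'⟩ := exists_neg_root j
    refine σ.sign_step (α := i') (β := j') ?_ (hi.2 i' hi') ((hs j hj).2 j' hj')
    rw [hk', hk, hi', hj', neg_add]
  obtain ⟨β, hβ⟩ := exists_neg_root α
  rcases (b.height_ne_zero α).lt_or_gt with h | h
  · have hpos : b.IsPos β := by rw [b.isPos_iff, height_neg hβ]; omega
    exact (key hpos).2 α (by rw [hβ, neg_neg])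
  · exact (key h).1

/-- The sign in `σ (x α) = ± x (σ α)`. -/
def sign (α : H.root) : ℤˣ := (σ.exists_sign α).choose

lemma toLieEquiv_x (α : H.root) :
    σ.toLieEquiv (C.x α) = (σ.sign α : ℤ) • C.x (σ.perm α) := (σ.exists_sign α).choose_spec

lemma iterate_order : (σ.toLieEquiv)^[σ.order] = id := by
  have h : σ.toLieEquiv.toLinearEquiv ^ σ.order = 1 := pow_orderOf_eq_one _
  have h2 : ∀ k : ℕ, ⇑(σ.toLieEquiv.toLinearEquiv ^ k) = (σ.toLieEquiv)^[k] := by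
    intro k
    induction k with
    | zero => rfl
    | succ k ih =>
      rw [pow_succ', Function.iterate_succ', ← ih]
      rfl
  rw [← h2, h]
  rfl

/-- The sign in `σ ^ j (x α) = ± x (σ ^ j α)`. -/
lemma exists_iterate_sign (α : H.root) (j : ℕ) :
    ∃ s : ℤˣ, (σ.toLieEquiv)^[j] (C.x α) = (s : ℤ) • C.x (σ.perm^[j] α) := by
  induction j with
  | zero => exact ⟨1, by simp⟩
  | succ j ih =>
    obtain ⟨s, hs⟩ := ih
    refine ⟨s * σ.sign (σ.perm^[j] α), ?_⟩
    rw [Function.iterate_succ_apply', hs, map_zsmul, toLieEquiv_x, Function.iterate_succ_apply',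
      Units.val_mul, mul_smul]

/-- The order is that of the Lie algebra automorphism. If its power `m` moved `α`, then `x_α` would
lie in two different root spaces. -/
lemma perm_iterate_order (α : H.root) : σ.perm^[σ.order] α = α := by
  obtain ⟨s, hs⟩ := σ.exists_iterate_sign α σ.order
  rw [iterate_order, id] at hs
  by_contra hne
  have hx : C.x α ∈ rootSpace H (α : LieModule.Weight ℂ H L) := C.x_mem α
  have hy : C.x α ∈ rootSpace H ((σ.perm^[σ.order] α : H.root) : LieModule.Weight ℂ H L) := by
    rw [hs]
    exact zsmul_mem (C.x_mem _) _
  have hd := (LieModule.iSupIndep_genWeightSpace' ℂ H L).pairwiseDisjoint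
    (fun h => hne (Subtype.ext h) : ((σ.perm^[σ.order] α : H.root) : LieModule.Weight ℂ H L) ≠ α)
  have h0 : C.x α ∈ (⊥ : LieSubmodule ℂ H L) := hd.le_bot ⟨hy, hx⟩
  exact chevalley_ne_zero C α (by simpa using h0)

lemma root_add_iterate_perm_ne_zero (α : H.root) (j : ℕ) :
    (rootSystem H).root α + (rootSystem H).root (σ.perm^[j] α) ≠ 0 := by
  intro h
  have h1 := height_neg (b := b) (eq_neg_of_add_eq_zero_right h)
  rw [height_iterate_perm] at h1
  have := b.height_ne_zero α
  omega

lemma root_perm_sub_notMem (α : H.root) :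
    (rootSystem H).root (σ.perm α) - (rootSystem H).root α ∉ range (rootSystem H).root := by
  rintro ⟨β, hβ⟩
  have h1 := b.height_sub hβ
  rw [height_perm, sub_self] at h1
  exact b.height_ne_zero β h1

lemma linearIndependent_perm {α : H.root} (h : σ.perm α ≠ α) :
    LinearIndependent ℂ ![(rootSystem H).root α, (rootSystem H).root (σ.perm α)] := by
  refine RootPairing.IsReduced.linearIndependent (rootSystem H) h.symm fun hc => ?_
  exact σ.root_add_iterate_perm_ne_zero α 1 (by rw [hc]; simp)

/-- The `α`-string through `σα` starts at `σα`, as `σα - α` is not a root; hence its length is minus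
the pairing. -/
lemma chainTopCoeff_perm_self {α : H.root} (h : σ.perm α ≠ α) :
    ((rootSystem H).chainTopCoeff α (σ.perm α) : ℤ) =
      -(rootSystem H).pairingIn ℤ (σ.perm α) α := by
  have h1 := RootPairing.chainBotCoeff_sub_chainTopCoeff (σ.linearIndependent_perm h)
  rw [RootPairing.chainBotCoeff_eq_zero_iff.mpr (Or.inr (σ.root_perm_sub_notMem α))] at h1
  rw [← h1]
  simp

lemma pairingIn_perm_self_neg {α γ : H.root} (h : σ.perm α ≠ α)
    (hγ : (rootSystem H).root γ = (rootSystem H).root α + (rootSystem H).root (σ.perm α)) :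
    (rootSystem H).pairingIn ℤ (σ.perm α) α < 0 := by
  have h1 : 1 ≤ (rootSystem H).chainTopCoeff α (σ.perm α) := by
    rw [← RootPairing.root_add_nsmul_mem_range_iff_le_chainTopCoeff (σ.linearIndependent_perm h)]
    exact ⟨γ, by rw [hγ, one_smul, add_comm]⟩
  have := σ.chainTopCoeff_perm_self h
  omega

end DiagramAut

lemma pairingIn_add_left {α β γ : H.root} (δ : H.root)
    (h : (rootSystem H).root γ = (rootSystem H).root α + (rootSystem H).root β) :
    (rootSystem H).pairingIn ℤ γ δ =
      (rootSystem H).pairingIn ℤ α δ + (rootSystem H).pairingIn ℤ β δ := by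
  have h1 : (rootSystem H).pairing γ δ =
      (rootSystem H).pairing α δ + (rootSystem H).pairing β δ := by
    rw [← RootPairing.root_coroot_eq_pairing, h, map_add, LinearMap.add_apply]
    rfl
  rw [← (rootSystem H).algebraMap_pairingIn ℤ, ← (rootSystem H).algebraMap_pairingIn ℤ,
    ← (rootSystem H).algebraMap_pairingIn ℤ] at h1
  simpa using mod_cast h1

namespace DiagramAut

/-- If `α + σα` were a root, `α, σα, σ²α` would pair negatively with one another, so their sum `δ`
would be a root, fixed by `σ`. Then `2 = ⟨δ, δ^∨⟩ = 3⟨α, δ^∨⟩`, which has no integral solution. -/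
lemma root_add_perm_notMem_of_order_eq_three (hσ : σ.order = 3) {α : H.root} (h : σ.perm α ≠ α) :
    (rootSystem H).root α + (rootSystem H).root (σ.perm α) ∉ range (rootSystem H).root := by
  rintro ⟨γ, hγ⟩
  have h3 : σ.perm (σ.perm (σ.perm α)) = α := by simpa [hσ] using σ.perm_iterate_order α
  have h1 := σ.pairingIn_perm_self_neg h hγ
  have h2 : (rootSystem H).pairingIn ℤ α (σ.perm α) < 0 := by
    rw [RootPairing.pairingIn_lt_zero_iff]
    exact h1
  have h4 : (rootSystem H).pairingIn ℤ α (σ.perm (σ.perm α)) < 0 := by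
    rw [← pairingIn_perm σ, h3]
    exact h1
  have h5 : (rootSystem H).pairingIn ℤ γ (σ.perm (σ.perm α)) < 0 := by
    rw [pairingIn_add_left _ hγ, pairingIn_perm]
    omega
  have hpos : (rootSystem H).root γ ≠ -(rootSystem H).root (σ.perm (σ.perm α)) := by
    intro hc
    have e1 := height_neg (b := b) hc
    rw [b.height_add hγ, height_perm, height_perm, height_perm] at e1
    have := b.height_ne_zero α
    omega
  obtain ⟨δ, hδ⟩ := (rootSystem H).root_add_root_mem_of_pairingIn_neg h5 hpos
  have hδσ : σ.perm δ = δ := by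
    apply (rootSystem H).root.injective
    rw [σ.root_perm_add hδ, σ.root_perm_add hγ, h3, hδ, hγ]
    abel
  have e : ∀ β : H.root, (rootSystem H).pairingIn ℤ (σ.perm β) δ =
      (rootSystem H).pairingIn ℤ β δ := by
    intro β
    conv_lhs => rw [← hδσ]
    exact pairingIn_perm σ β δ
  have e2 := pairingIn_add_left δ hδ
  rw [pairingIn_add_left δ hγ, e, e, e, RootPairing.pairingIn_same] at e2
  omega

/-- For an involution the pairings of `α` with `σα` in both orders agree. If `σα + 2α` were a root,
both would be at most `-2`, which is impossible for independent roots. -/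
lemma root_two_smul_add_perm_notMem (hσ : σ.order = 2) {α : H.root} (h : σ.perm α ≠ α) :
    (rootSystem H).root (σ.perm α) + 2 • (rootSystem H).root α ∉ range (rootSystem H).root := by
  rw [RootPairing.root_add_nsmul_mem_range_iff_le_chainTopCoeff (σ.linearIndependent_perm h)]
  intro h1
  have h2 : σ.perm (σ.perm α) = α := by simpa [hσ] using σ.perm_iterate_order α
  have h3 := σ.chainTopCoeff_perm_self h
  have h4 := σ.pairingIn_perm α (σ.perm α)
  rw [h2] at h4
  have h5 := RootPairing.IsReduced.linearIndependent_iff (rootSystem H) |>.mp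
    (σ.linearIndependent_perm h)
  have h6 := (rootSystem H).pairingIn_pairingIn_mem_set_of_isCrystal_of_isRed' _ _
    ((rootSystem H).root.injective.ne h5.1) h5.2
  rw [← h4] at h6
  have h7 : (rootSystem H).pairingIn ℤ (σ.perm α) α ≤ -2 := by omega
  simp only [Set.mem_insert_iff, Set.mem_singleton_iff, Prod.mk.injEq] at h6
  omega

lemma perm_eq_self_of_add (hσ : σ.order = 2) {α γ : H.root}
    (hγ : (rootSystem H).root γ = (rootSystem H).root α + (rootSystem H).root (σ.perm α)) :
    σ.perm γ = γ := by
  have h2 : σ.perm (σ.perm α) = α := by simpa [hσ] using σ.perm_iterate_order α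
  apply (rootSystem H).root.injective
  rw [σ.root_perm_add hγ, h2, hγ, add_comm]

/-- Since `2α + σα` is not a root. Together with the analogue for `σα`, this makes `x_α, x_{σα},
x_γ` span a Heisenberg algebra. -/
lemma lie_add_perm_eq_zero (hσ : σ.order = 2) {α γ : H.root} (h : σ.perm α ≠ α)
    (hγ : (rootSystem H).root γ = (rootSystem H).root α + (rootSystem H).root (σ.perm α)) :
    ⁅C.x α, C.x γ⁆ = 0 := by
  refine chevalley_lie_eq_zero C ?_ ?_
  · intro hc
    have e1 := height_neg (b := b) (eq_neg_of_add_eq_zero_right hc)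
    rw [b.height_add hγ, height_perm] at e1
    have := b.height_ne_zero α
    omega
  · rw [hγ, show (rootSystem H).root α +
      ((rootSystem H).root α + (rootSystem H).root (σ.perm α)) =
      (rootSystem H).root (σ.perm α) + 2 • (rootSystem H).root α by rw [two_smul]; abel]
    exact σ.root_two_smul_add_perm_notMem hσ h

lemma lie_perm_add_perm_eq_zero (hσ : σ.order = 2) {α γ : H.root} (h : σ.perm α ≠ α)
    (hγ : (rootSystem H).root γ = (rootSystem H).root α + (rootSystem H).root (σ.perm α)) :
    ⁅C.x (σ.perm α), C.x γ⁆ = 0 := by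
  have h2 : σ.perm (σ.perm α) = α := by simpa [hσ] using σ.perm_iterate_order α
  refine σ.lie_add_perm_eq_zero hσ ?_ ?_
  · rw [h2]; exact h.symm
  · rw [h2, hγ, add_comm]

lemma lie_perm_eq_zero {α : H.root}
    (h : (rootSystem H).root α + (rootSystem H).root (σ.perm α) ∉ range (rootSystem H).root) :
    ⁅C.x α, C.x (σ.perm α)⁆ = 0 :=
  chevalley_lie_eq_zero C (σ.root_add_iterate_perm_ne_zero α 1) h

end DiagramAut

end Roots

/-! ### Brackets in the loop algebra, and maps out of enveloping algebras. -/

section Monom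

variable {L : Type*} [LieRing L] [LieAlgebra ℂ L]

lemma monom_lie (x y : L) (r s : ℤ) : ⁅monom x r, monom y s⁆ = monom ⁅x, y⁆ (r + s) := by
  rw [monom, monom, monom, LieAlgebra.ExtendScalars.bracket_tmul, LaurentPolynomial.T_add]

lemma monom_add (x y : L) (r : ℤ) : monom (x + y) r = monom x r + monom y r :=
  TensorProduct.tmul_add _ _ _

lemma monom_smul (c : ℂ) (x : L) (r : ℤ) : monom (c • x) r = c • monom x r :=
  TensorProduct.tmul_smul _ _ _

end Monom

section Enveloping

variable {M A : Type*} [LieRing M] [LieAlgebra ℂ M] [Ring A] [Algebra ℂ A]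

attribute [local instance] LieRing.ofAssociativeRing

/-- The homomorphism from an enveloping algebra attached to a linear map that turns brackets into
commutators. -/
def envelopingLift (f : M →ₗ[ℂ] A) (hf : ∀ x y, f ⁅x, y⁆ = f x * f y - f y * f x) :
    UniversalEnvelopingAlgebra ℂ M →ₐ[ℂ] A :=
  UniversalEnvelopingAlgebra.lift ℂ
    { f with map_lie' := fun {x y} => (hf x y).trans (LieRing.of_associative_ring_bracket _ _).symm }

lemma envelopingLift_ι (f : M →ₗ[ℂ] A) (hf : ∀ x y, f ⁅x, y⁆ = f x * f y - f y * f x) (x : M) :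
    envelopingLift f hf (UniversalEnvelopingAlgebra.ι ℂ x) = f x :=
  UniversalEnvelopingAlgebra.lift_ι_apply ℂ _ x

lemma map_lie_eq_of_basis {ι : Type*} (e : Module.Basis ι ℂ M) (f : M →ₗ[ℂ] A)
    (h0 : ∀ i j, f ⁅e i, e j⁆ = f (e i) * f (e j) - f (e j) * f (e i)) (x y : M) :
    f ⁅x, y⁆ = f x * f y - f y * f x := by
  have h1 : ∀ i y, f ⁅e i, y⁆ = f (e i) * f y - f y * f (e i) := by
    intro i y
    induction e.mem_span y using Submodule.span_induction with
    | mem y hy => obtain ⟨j, rfl⟩ := hy; exact h0 i j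
    | zero => simp
    | add y z _ _ hy hz => rw [lie_add, map_add, hy, hz, map_add]; noncomm_ring
    | smul c y _ hy => rw [lie_smul, map_smul, hy, map_smul, mul_smul_comm, smul_mul_assoc, smul_sub]
  induction e.mem_span x using Submodule.span_induction with
  | mem x hx => obtain ⟨i, rfl⟩ := hx; exact h1 i y
  | zero => simp
  | add x z _ _ hx hz => rw [add_lie, map_add, hx, hz, map_add]; noncomm_ring
  | smul c x _ hx => rw [smul_lie, map_smul, hx, map_smul, mul_smul_comm, smul_mul_assoc, smul_sub]

end Enveloping

/-! ### Integral structure of the loop algebra and linear disjointness from `ℤ[ζ, √2]`. -/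

section Chevalley

open LieAlgebra LieAlgebra.IsKilling Set Module

variable {L : Type*} [LieRing L] [LieAlgebra ℂ L] [IsKilling ℂ L] [FiniteDimensional ℂ L]
  {H : LieSubalgebra ℂ L} [H.IsCartanSubalgebra]
  (b : (rootSystem H).Base) (C : ChevalleyBasis H)

/-- The simple coroots together with the root vectors. -/
def chevalleyFamily : b.support ⊕ H.root → L :=
  Sum.elim (fun i => (((rootSystem H).coroot i : H) : L)) C.x

/-- Weight spaces are independent, `H` is the one of weight zero, and the simple coroots are a basis
of `H`. -/
lemma linearIndependent_chevalleyFamily : LinearIndependent ℂ (chevalleyFamily b C) := by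
  have hind := LieSubmodule.iSupIndep_toSubmodule.mpr (LieModule.iSupIndep_genWeightSpace ℂ H L)
  refine LinearIndependent.sum_type ?_ ?_ ?_
  · have h := (b.toCoweightBasis).linearIndependent.map' H.toSubmodule.subtype
      (Submodule.ker_subtype _)
    convert! h using 1
    ext i
    exact congrArg Subtype.val (b.toCoweightBasis_apply i).symm
  · have hind' := LieSubmodule.iSupIndep_toSubmodule.mpr (LieModule.iSupIndep_genWeightSpace' ℂ H L)
    have := hind'.comp (f := fun α : H.root => (α : LieModule.Weight ℂ H L))
      Subtype.val_injective
    exact this.linearIndependent _ (fun α => C.x_mem α) (chevalley_ne_zero C)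
  · refine (hind 0).mono ?_ ?_
    · rw [Submodule.span_le]
      rintro _ ⟨i, rfl⟩
      have : (((rootSystem H).coroot i : H) : L) ∈ H.toLieSubmodule := SetLike.coe_mem _
      rw [← rootSpace_zero_eq] at this
      exact this
    · rw [Submodule.span_le]
      rintro _ ⟨α, rfl⟩
      refine Submodule.mem_iSup_of_mem (α : LieModule.Weight ℂ H L) ?_
      refine Submodule.mem_iSup_of_mem ?_ (C.x_mem α)
      exact fun h => H.isNonZero_coe_root α h

lemma span_chevalleyFamily : ⊤ ≤ Submodule.span ℂ (range (chevalleyFamily b C)) := by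
  have htop := LieSubmodule.iSup_toSubmodule_eq_top.mpr (LieModule.iSup_genWeightSpace_eq_top' ℂ H L)
  rw [← htop]
  refine iSup_le fun χ => ?_
  by_cases hχ : χ.IsZero
  · intro x hx
    rw [show (χ : H → ℂ) = 0 from hχ] at hx
    have hx' : x ∈ rootSpace H (0 : H → ℂ) := hx
    rw [rootSpace_zero_eq] at hx'
    have h1 : (⟨x, hx'⟩ : H) ∈ Submodule.span ℂ (range b.toCoweightBasis) := by
      rw [Basis.span_eq]; trivial
    have h2 := Submodule.mem_map_of_mem (f := H.toSubmodule.subtype) h1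
    rw [Submodule.map_span, ← range_comp] at h2
    refine Submodule.span_mono ?_ h2
    rintro _ ⟨i, rfl⟩
    exact ⟨Sum.inl i, by simp [chevalleyFamily]⟩
  · intro x hx
    let α : H.root := ⟨χ, by simpa using hχ⟩
    have h1 := (finrank_eq_one_iff_of_nonzero' (⟨C.x α, C.x_mem α⟩ : rootSpace H χ)
      (fun h => chevalley_ne_zero C α (congrArg Subtype.val h))).mp
      (finrank_rootSpace_eq_one χ hχ) ⟨x, hx⟩
    obtain ⟨c, hc⟩ := h1
    have hc' : c • C.x α = x := congrArg Subtype.val hc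
    rw [← hc']
    exact Submodule.smul_mem _ _ (Submodule.subset_span ⟨Sum.inr α, rfl⟩)

/-- The basis of `L` formed by the simple coroots and the root vectors. -/
def chevalleyLinearBasis : Basis (b.support ⊕ H.root) ℂ L :=
  Basis.mk (linearIndependent_chevalleyFamily b C) (span_chevalleyFamily b C)

lemma chevalleyLinearBasis_apply (i) : chevalleyLinearBasis b C i = chevalleyFamily b C i :=
  Basis.mk_apply _ _ i

lemma coroot_mem_span_chevalleyFamily (α : H.root) :
    (((rootSystem H).coroot α : H) : L) ∈ Submodule.span ℤ (range (chevalleyFamily b C)) := by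
  have h := Submodule.mem_map_of_mem (f := (H.toSubmodule.subtype).restrictScalars ℤ)
    (b.coroot_mem_span_int α)
  rw [Submodule.map_span] at h
  refine Submodule.span_mono ?_ h
  rintro _ ⟨_, ⟨i, hi, rfl⟩, rfl⟩
  exact ⟨Sum.inl ⟨i, hi⟩, rfl⟩

lemma lie_coroot_x (α β : H.root) :
    ⁅(((rootSystem H).coroot α : H) : L), C.x β⁆ = (rootSystem H).pairingIn ℤ β α • C.x β := by
  have h := lie_eq_smul_of_mem_rootSpace (C.x_mem β) ((rootSystem H).coroot α)
  rw [← Int.cast_smul_eq_zsmul ℂ]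
  refine h.trans ?_
  congr 1
  exact ((rootSystem H).algebraMap_pairingIn ℤ β α).symm

lemma lie_chevalleyFamily_mem (i j : b.support ⊕ H.root) :
    ⁅chevalleyFamily b C i, chevalleyFamily b C j⁆ ∈
      Submodule.span ℤ (range (chevalleyFamily b C)) := by
  have hx : ∀ α, C.x α ∈ Submodule.span ℤ (range (chevalleyFamily b C)) :=
    fun α => Submodule.subset_span ⟨Sum.inr α, rfl⟩
  rcases i with i | α <;> rcases j with j | β
  · have h : ⁅(rootSystem H).coroot i, (rootSystem H).coroot j⁆ = 0 := trivial_lie_zero _ _ _ _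
    have h2 := congrArg (Subtype.val) h
    simp only [chevalleyFamily, Sum.elim_inl]
    rw [← LieSubalgebra.coe_bracket, h]
    exact zero_mem _
  · simp only [chevalleyFamily, Sum.elim_inl, Sum.elim_inr]
    rw [lie_coroot_x]
    exact Submodule.smul_mem _ _ (hx β)
  · simp only [chevalleyFamily, Sum.elim_inl, Sum.elim_inr]
    rw [← lie_skew, lie_coroot_x]
    exact neg_mem (Submodule.smul_mem _ _ (hx α))
  · simp only [chevalleyFamily, Sum.elim_inr]
    by_cases h0 : (rootSystem H).root α + (rootSystem H).root β = 0
    · rw [C.lie_neg α β (eq_neg_of_add_eq_zero_right h0)]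
      exact coroot_mem_span_chevalleyFamily b C α
    by_cases h1 : (rootSystem H).root α + (rootSystem H).root β ∈ range (rootSystem H).root
    · obtain ⟨γ, hγ⟩ := h1
      rcases C.lie_add α β γ hγ with h | h <;> rw [h]
      · exact nsmul_mem (hx γ) _
      · exact neg_mem (nsmul_mem (hx γ) _)
    · rw [chevalley_lie_eq_zero C h0 h1]
      exact zero_mem _

/-- The basis of the loop algebra consisting of the elements `e ⊗ t ^ r`. -/
def loopBasis : Basis (ℤ × (b.support ⊕ H.root)) ℂ (Loop L) :=
  (AddMonoidAlgebra.basis ℤ ℂ).tensorProduct (chevalleyLinearBasis b C)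

lemma loopBasis_apply (r : ℤ) (i) : loopBasis b C (r, i) = monom (chevalleyFamily b C i) r := by
  rw [loopBasis, Basis.tensorProduct_apply, chevalleyLinearBasis_apply, monom]
  congr 1

lemma lie_loopBasis_mem (i j) :
    ⁅loopBasis b C i, loopBasis b C j⁆ ∈ Submodule.span ℤ (range (loopBasis b C)) := by
  obtain ⟨r, i⟩ := i
  obtain ⟨s, j⟩ := j
  rw [loopBasis_apply, loopBasis_apply, monom_lie]
  let f : L →ₗ[ℤ] Loop L := (AddMonoidHom.mk' (fun x => monom x (r + s))
    (fun x y => monom_add x y _)).toIntLinearMap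
  have h := Submodule.mem_map_of_mem (f := f) (lie_chevalleyFamily_mem b C i j)
  rw [Submodule.map_span] at h
  refine Submodule.span_mono ?_ h
  rintro _ ⟨_, ⟨k, rfl⟩, rfl⟩
  exact ⟨(r + s, k), loopBasis_apply b C _ _⟩

attribute [local instance] LieRing.ofAssociativeRing

variable (L) in
/-- The algebra `ℂ ⊗ U(g̃)`, an algebra over `ℂ` through the left factor. -/
abbrev ExtendedEnveloping : Type _ := ℂ ⊗[ℤ] UniversalEnvelopingAlgebra ℂ (Loop L)

/-- The linear map with `e ⊗ t ^ r ↦ 1 ⊗ (e ⊗ t ^ r)` for `e` in the Chevalley basis. -/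
def rationalLinear : Loop L →ₗ[ℂ] ExtendedEnveloping L :=
  (loopBasis b C).constr ℂ fun i => 1 ⊗ₜ[ℤ] UniversalEnvelopingAlgebra.ι ℂ (loopBasis b C i)

lemma rationalLinear_apply_of_mem {z : Loop L}
    (hz : z ∈ Submodule.span ℤ (range (loopBasis b C))) :
    rationalLinear b C z = 1 ⊗ₜ[ℤ] UniversalEnvelopingAlgebra.ι ℂ z := by
  induction hz using Submodule.span_induction with
  | mem x hx =>
    obtain ⟨i, rfl⟩ := hx
    exact (loopBasis b C).constr_basis ℂ _ i
  | zero => simp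
  | add x y _ _ hx hy => rw [map_add, map_add, TensorProduct.tmul_add, hx, hy]
  | smul n x _ hx => rw [map_zsmul, map_zsmul, TensorProduct.tmul_smul, hx]

/-- The two copies of `ℂ` in `ℂ ⊗ U(g̃)` are tensored over `ℤ` only, so this rests on integral
structure constants: brackets of basis vectors stay in the integral span, where the map is `1 ⊗ ι`.
-/
lemma rationalLinear_lie (x y : Loop L) :
    rationalLinear b C ⁅x, y⁆ = rationalLinear b C x * rationalLinear b C y -
      rationalLinear b C y * rationalLinear b C x := by
  have h0 : ∀ i j, rationalLinear b C ⁅loopBasis b C i, loopBasis b C j⁆ =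
      rationalLinear b C (loopBasis b C i) * rationalLinear b C (loopBasis b C j) -
      rationalLinear b C (loopBasis b C j) * rationalLinear b C (loopBasis b C i) := by
    intro i j
    rw [rationalLinear_apply_of_mem b C (lie_loopBasis_mem b C i j),
      rationalLinear_apply_of_mem b C (Submodule.subset_span ⟨i, rfl⟩),
      rationalLinear_apply_of_mem b C (Submodule.subset_span ⟨j, rfl⟩),
      LieHom.map_lie, LieRing.of_associative_ring_bracket, Algebra.TensorProduct.tmul_mul_tmul,
      Algebra.TensorProduct.tmul_mul_tmul, TensorProduct.tmul_sub, one_mul]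
  exact map_lie_eq_of_basis (loopBasis b C) _ h0 x y

/-- The homomorphism `U(g̃) → ℂ ⊗ U(g̃)` describing the rational structure of `U(g̃)`. -/
def rationalHom : UniversalEnvelopingAlgebra ℂ (Loop L) →ₐ[ℂ] ExtendedEnveloping L :=
  envelopingLift (rationalLinear b C) (rationalLinear_lie b C)

lemma rationalHom_loopGen (α : H.root) (r : ℤ) (k : ℕ) :
    rationalHom b C (loopGen C α r k) = 1 ⊗ₜ[ℤ] loopGen C α r k := by
  have h : rationalHom b C (UniversalEnvelopingAlgebra.ι ℂ (monom (C.x α) r)) =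
      1 ⊗ₜ[ℤ] UniversalEnvelopingAlgebra.ι ℂ (monom (C.x α) r) := by
    rw [rationalHom, envelopingLift_ι]
    exact rationalLinear_apply_of_mem b C
      (Submodule.subset_span ⟨(r, Sum.inr α), loopBasis_apply b C _ _⟩)
  have hk : (k.factorial : ℂ) ≠ 0 := by exact_mod_cast k.factorial_ne_zero
  rw [loopGen, map_divPow, h]
  set a := UniversalEnvelopingAlgebra.ι ℂ (monom (C.x α) r)
  -- The integer `k!` may cross the tensor product over `ℤ`, whereas `1 / k!` may not.
  have ha : a ^ k = (k.factorial : ℤ) • divPow a k := by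
    rw [divPow, ← Int.cast_smul_eq_zsmul ℂ, smul_smul, Int.cast_natCast, mul_inv_cancel₀ hk,
      one_smul]
  rw [divPow, Algebra.TensorProduct.tmul_pow, one_pow, ha, TensorProduct.tmul_smul,
    ← Int.cast_smul_eq_zsmul ℂ, smul_smul, Int.cast_natCast, inv_mul_cancel₀ hk, one_smul]

lemma rationalHom_coe (v : loopForm C) :
    rationalHom b C v = 1 ⊗ₜ[ℤ] (v : UniversalEnvelopingAlgebra ℂ (Loop L)) := by
  obtain ⟨v, hv⟩ := v
  induction hv using Algebra.adjoin_induction with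
  | mem x hx => obtain ⟨α, r, k, rfl⟩ := hx; exact rationalHom_loopGen b C α r k
  | algebraMap n =>
    change rationalHom b C (algebraMap ℤ _ n) = 1 ⊗ₜ[ℤ] (algebraMap ℤ _ n)
    rw [eq_intCast, map_intCast]
    exact (map_intCast (Algebra.TensorProduct.includeRight :
      UniversalEnvelopingAlgebra ℂ (Loop L) →ₐ[ℤ] ExtendedEnveloping L) n).symm
  | add x y _ _ hx hy => rw [map_add, hx, hy, TensorProduct.tmul_add]
  | mul x y _ _ hx hy => rw [map_mul, hx, hy, Algebra.TensorProduct.tmul_mul_tmul, one_mul]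

/-- Reduces the injectivity of `coeffMul` to that of a tensor product of two inclusions over `ℤ`. -/
lemma rationalHom_coeffMul (ζ : ℂˣ) (w : (coeffRing ζ) ⊗[ℤ] (loopForm C)) :
    rationalHom b C (coeffMul C ζ w) =
      TensorProduct.map (coeffRing ζ).val.toLinearMap (loopForm C).val.toLinearMap w := by
  induction w using TensorProduct.induction_on with
  | zero => simp
  | add x y hx hy => rw [map_add, map_add, map_add, hx, hy]
  | tmul s v =>
    have h1 : coeffMul C ζ (s ⊗ₜ v) = (s : ℂ) • (v : UniversalEnvelopingAlgebra ℂ (Loop L)) := by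
      rw [Algebra.smul_def]
      exact Algebra.TensorProduct.lift_tmul _ _ _ _ _
    rw [h1, map_smul, rationalHom_coe, TensorProduct.smul_tmul', smul_eq_mul, mul_one]
    rfl

include b in
/-- The integral form of the loop algebra is linearly disjoint from `ℤ[ζ, √2]`. -/
lemma coeffMul_injective (ζ : ℂˣ) : Function.Injective (coeffMul C ζ) := by
  -- Torsion-free `ℤ`-modules are flat, so tensoring the two inclusions preserves injectivity.
  have hU : Module.IsTorsionFree ℤ (UniversalEnvelopingAlgebra ℂ (Loop L)) :=
    Module.IsTorsionFree.trans ℂ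
  have hV : Module.IsTorsionFree ℤ (loopForm C) :=
    Subtype.val_injective.moduleIsTorsionFree (fun x : loopForm C =>
      (x : UniversalEnvelopingAlgebra ℂ (Loop L))) fun _ _ => rfl
  have h := TensorProduct.map_injective_of_flat_flat (coeffRing ζ).val.toLinearMap
    (loopForm C).val.toLinearMap Subtype.val_injective Subtype.val_injective
  intro w w' hw
  apply h
  rw [← rationalHom_coeffMul b, hw, rationalHom_coeffMul]

end Chevalley

/-! ### Coprimality and interpolation for Laurent polynomials under `t ↦ ω t`. -/

section Laurent

open Polynomial LaurentPolynomial

variable {F : Type*} [Field F]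

/-- The substitution `t ↦ ω t` in Laurent polynomials. -/
def scaleLaurent (ω : Fˣ) : F[T;T⁻¹] →ₐ[F] F[T;T⁻¹] :=
  AddMonoidAlgebra.lift F F[T;T⁻¹] ℤ
    { toFun := fun j => ((ω ^ (Multiplicative.toAdd j) : Fˣ) : F) •
        (LaurentPolynomial.T (Multiplicative.toAdd j) : F[T;T⁻¹])
      map_one' := by simp
      map_mul' := fun a b => by
        rw [toAdd_mul, zpow_add, LaurentPolynomial.T_add, Units.val_mul, smul_mul_smul_comm] }

lemma scaleLaurent_T (ω : Fˣ) (r : ℤ) :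
    scaleLaurent ω (T r) = ((ω ^ r : Fˣ) : F) • (T r : F[T;T⁻¹]) := by
  rw [scaleLaurent, LaurentPolynomial.T, AddMonoidAlgebra.lift_single, one_smul]
  rfl

lemma laurent_span_T : Submodule.span F (Set.range (T : ℤ → F[T;T⁻¹])) = ⊤ := by
  rw [eq_top_iff]
  rintro p -
  induction p using LaurentPolynomial.induction_on' with
  | add p q hp hq => exact add_mem hp hq
  | C_mul_T n a =>
    rw [← LaurentPolynomial.smul_eq_C_mul]
    exact Submodule.smul_mem _ _ (Submodule.subset_span ⟨n, rfl⟩)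

lemma scaleLaurent_scaleLaurent (ω ω' : Fˣ) (p : F[T;T⁻¹]) :
    scaleLaurent ω (scaleLaurent ω' p) = scaleLaurent (ω * ω') p := by
  have h : (scaleLaurent ω).toLinearMap ∘ₗ (scaleLaurent ω').toLinearMap =
      (scaleLaurent (ω * ω')).toLinearMap := by
    refine LinearMap.ext_on_range (v := (T : ℤ → F[T;T⁻¹])) laurent_span_T fun r => ?_
    simp only [LinearMap.comp_apply, AlgHom.toLinearMap_apply, scaleLaurent_T, map_smul, smul_smul,
      mul_zpow, Units.val_mul, mul_comm]
  exact LinearMap.congr_fun h p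

lemma scaleLaurent_one (p : F[T;T⁻¹]) : scaleLaurent 1 p = p := by
  have h : (scaleLaurent (1 : Fˣ)).toLinearMap = LinearMap.id := by
    refine LinearMap.ext_on_range (v := (T : ℤ → F[T;T⁻¹])) laurent_span_T fun r => ?_
    simp [scaleLaurent_T]
  exact LinearMap.congr_fun h p

/-- The combination `ω(t - a) - (ωt - c) = c - ωa` is a nonzero constant. -/
lemma isCoprime_scaleLaurent_linear (ω : Fˣ) {a c : F} (h : c ≠ ω * a) :
    IsCoprime (T 1 - LaurentPolynomial.C a) (scaleLaurent ω (T 1 - LaurentPolynomial.C c)) := by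
  have h1 : scaleLaurent ω (T 1 - LaurentPolynomial.C c) =
      LaurentPolynomial.C (ω : F) * T 1 - LaurentPolynomial.C c := by
    rw [map_sub, scaleLaurent_T, zpow_one, LaurentPolynomial.smul_eq_C_mul]
    congr 1
    exact (scaleLaurent ω).commutes c
  have h2 : c - ω * a ≠ 0 := sub_ne_zero.mpr h
  refine ⟨LaurentPolynomial.C ((c - ω * a)⁻¹ * ω), -LaurentPolynomial.C ((c - ω * a)⁻¹), ?_⟩
  rw [h1]
  have h3 : (LaurentPolynomial.C ((c - ω * a)⁻¹) : F[T;T⁻¹]) * LaurentPolynomial.C (c - ω * a) = 1 := by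
    rw [← map_mul, inv_mul_cancel₀ h2, map_one]
  rw [map_sub, map_mul] at h3
  rw [map_mul]
  linear_combination h3

open scoped Classical in
lemma tildePoly_prod_pow {n : ℕ} (a : Fin n → F) (N : ℕ) :
    tildePoly ((∏ j, (1 - Polynomial.C (a j) * X)) ^ N) =
      (∏ j with a j ≠ 0, (X - Polynomial.C (a j))) ^ N := by
  have key : ∀ s : Finset (Fin n), (∏ j ∈ s, (1 - Polynomial.C (a j) * X)).reverse =
      ∏ j ∈ s with a j ≠ 0, (X - Polynomial.C (a j)) := by
    intro s
    induction s using Finset.induction_on with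
    | empty =>
      rw [Finset.prod_empty, Finset.filter_empty, Finset.prod_empty, ← Polynomial.C_1, reverse_C]
    | insert i s hi ih =>
      rw [Finset.prod_insert hi, reverse_mul_of_domain, ih, Finset.filter_insert]
      split_ifs with h
      · rw [Finset.prod_insert (by simp [hi])]
        congr 1
        simpa [tildePoly] using tildePoly_prod (fun _ : Fin 1 => a i) (fun _ => h)
      · rw [not_not] at h
        rw [h, map_zero, zero_mul, sub_zero, ← Polynomial.C_1, reverse_C, Polynomial.C_1, one_mul]
  rw [tildePoly]
  induction N with
  | zero => rw [pow_zero, pow_zero, ← Polynomial.C_1, reverse_C]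
  | succ N ih => rw [pow_succ, reverse_mul_of_domain, ih, key, pow_succ]

-- A common root of the two sides means `a_j = ω a_i` with `a_i ≠ 0`. Taking `m`-th powers forces `i
-- = j`, and then `ω = 1`.
open scoped Classical in
lemma isCoprime_scaleLaurent {n m : ℕ} {a : Fin n → F}
    (ha : ∀ i j, i ≠ j → a i ^ m ≠ a j ^ m) (N : ℕ) {ω : Fˣ} (hω : ω ^ m = 1) (hω1 : ω ≠ 1) :
    IsCoprime (toLaurent (tildePoly ((∏ j, (1 - Polynomial.C (a j) * X)) ^ N)))
      (scaleLaurent ω (toLaurent (tildePoly ((∏ j, (1 - Polynomial.C (a j) * X)) ^ N)))) := by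
  rw [tildePoly_prod_pow, map_pow, map_pow, map_prod, map_prod]
  refine IsCoprime.pow (IsCoprime.prod_left fun i hi => IsCoprime.prod_right fun j _ => ?_)
  rw [map_sub, map_sub, toLaurent_X, toLaurent_C, toLaurent_C]
  refine isCoprime_scaleLaurent_linear ω fun h => ?_
  have hi0 : a i ≠ 0 := (Finset.mem_filter.mp hi).2
  have hij : i = j := by
    by_contra hne
    apply ha i j hne
    rw [h, mul_pow, ← Units.val_pow_eq_pow_val, hω, Units.val_one, one_mul]
  subst hij
  apply hω1
  ext
  rw [Units.val_one]
  exact mul_right_cancel₀ hi0 (by rw [one_mul, ← h])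

/-- Interpolation: if the conjugates of `h` under `t ↦ ω t` are coprime to `h`, then any residue
modulo `h` has a representative whose conjugates are divisible by `h`. -/
lemma exists_interpolation {m : ℕ} {ω : Fˣ} (hω : ω ^ m = 1) {h : F[T;T⁻¹]}
    (hh : ∀ j, 0 < j → j < m → IsCoprime h (scaleLaurent (ω ^ j) h)) (q : F[T;T⁻¹]) :
    ∃ p, h ∣ p - q ∧ ∀ j, 0 < j → j < m → h ∣ scaleLaurent (ω ^ j) p := by
  obtain ⟨u, v, huv⟩ : IsCoprime h (∏ j ∈ Finset.Ico 1 m, scaleLaurent (ω ^ (m - j)) h) :=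
    IsCoprime.prod_right fun j hj => by
      rw [Finset.mem_Ico] at hj
      exact hh _ (by omega) (by omega)
  -- The exponent `m - j` is chosen so that `t ↦ ω^j t` turns the `j`-th factor of `g` into `h(ω^m
  -- t) = h`; and `uh + vg = 1` makes `vgq` congruent to `q`.
  set g := ∏ j ∈ Finset.Ico 1 m, scaleLaurent (ω ^ (m - j)) h
  refine ⟨v * g * q, ⟨-u * q, by linear_combination q * huv⟩, fun j hj hjm => ?_⟩
  have h1 : scaleLaurent (ω ^ (m - j)) h ∣ v * g * q :=
    ((Finset.dvd_prod_of_mem _ (Finset.mem_Ico.mpr ⟨hj, hjm⟩)).mul_left v).mul_right q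
  have h2 := map_dvd (scaleLaurent (ω ^ j)) h1
  rwa [scaleLaurent_scaleLaurent, ← pow_add, Nat.add_sub_cancel' hjm.le, hω, scaleLaurent_one]
    at h2

/-- The sum `∑ ω^(-sj) p(ω^j t)` retains only exponents congruent to `s` mod `m`, so it lies in `W`.
For an interpolating `p`, all its terms except `p` itself are divisible by `h`; hence `p`, and then
`q`, lies in `W`. -/
lemma eq_top_of_T_mem {m : ℕ} (hm : 0 < m) {ω : Fˣ} (hω : IsPrimitiveRoot ω m) {h : F[T;T⁻¹]}
    (hh : ∀ j, 0 < j → j < m → IsCoprime h (scaleLaurent (ω ^ j) h))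
    {W : Submodule F F[T;T⁻¹]} (hW : ∀ q, h ∣ q → q ∈ W) (s : ℤ)
    (hT : ∀ r : ℤ, (m : ℤ) ∣ r - s → T r ∈ W) : W = ⊤ := by
  rw [eq_top_iff]
  rintro q -
  obtain ⟨p, hp, hpj⟩ := exists_interpolation hω.pow_eq_one hh q
  have key : ∀ p : F[T;T⁻¹], ∑ j ∈ Finset.range m,
      ((ω ^ (-(s * j)) : Fˣ) : F) • scaleLaurent (ω ^ j) p ∈ W := by
    intro p
    have hp : p ∈ Submodule.span F (Set.range (T : ℤ → F[T;T⁻¹])) := by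
      rw [laurent_span_T]; trivial
    induction hp using Submodule.span_induction with
    | mem x hx =>
      obtain ⟨r, rfl⟩ := hx
      have e : ∀ j : ℕ, ((ω ^ (-(s * j)) : Fˣ) : F) • scaleLaurent (ω ^ j) (T r) =
          (((ω ^ (r - s) : Fˣ) : F) ^ j) • T r := by
        intro j
        rw [scaleLaurent_T, smul_smul]
        congr 1
        norm_cast
        rw [← zpow_natCast, ← zpow_mul, ← zpow_add, ← zpow_natCast, ← zpow_mul]
        congr 1
        ring
      rw [Finset.sum_congr rfl fun j _ => e j, ← Finset.sum_smul]
      by_cases hr : (m : ℤ) ∣ r - s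
      · exact W.smul_mem _ (hT r hr)
      · have h1 : ((ω ^ (r - s) : Fˣ) : F) ≠ 1 := by
          rw [Ne, Units.val_eq_one, hω.zpow_eq_one_iff_dvd]
          exact hr
        have h2 := mul_neg_geom_sum (((ω ^ (r - s) : Fˣ) : F)) m
        have h3 : (((ω ^ (r - s) : Fˣ) : F)) ^ m = 1 := by
          norm_cast
          rw [← zpow_natCast, ← zpow_mul, mul_comm, zpow_mul, zpow_natCast, hω.pow_eq_one, one_zpow, Units.val_one]
        rw [h3, sub_self, mul_eq_zero] at h2
        rw [h2.resolve_left (sub_ne_zero.mpr h1.symm), zero_smul]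
        exact W.zero_mem
    | zero => simp
    | add x y _ _ hx hy =>
      simp only [map_add, smul_add, Finset.sum_add_distrib]
      exact W.add_mem hx hy
    | smul c x _ hx =>
      simp only [map_smul]
      convert W.smul_mem c hx using 1
      rw [Finset.smul_sum]
      exact Finset.sum_congr rfl fun j _ => smul_comm _ _ _
  have h0 := key p
  rw [← Finset.add_sum_erase _ _ (Finset.mem_range.mpr hm)] at h0
  simp only [Nat.cast_zero, mul_zero, neg_zero, zpow_zero, Units.val_one, pow_zero, one_smul,
    scaleLaurent_one] at h0
  have h1 : p ∈ W := (W.add_mem_iff_left (W.sum_mem fun j hj => W.smul_mem _ (hW _ ?_))).mp h0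
  · have h2 := W.sub_mem h1 (hW _ hp)
    rwa [sub_sub_cancel] at h2
  · rw [Finset.mem_erase, Finset.mem_range] at hj
    exact hpj j (Nat.pos_of_ne_zero hj.1) hj.2

end Laurent

/-! ### Divided powers along Laurent polynomials over an arbitrary field. -/

section Family

open PowerSeries

universe u

variable {K : Type*} {A : Type u} [Field K] [Ring A] [Algebra K A] (g : ℤ → ℕ → A)

/-- The generating series `∏ (∑ c_i ^ k g_i^(k) X ^ k)` attached to families of divided powers
`g_i^(k)` and a Laurent polynomial `∑ c_i t ^ i`. -/
def familySeries (p : K[T;T⁻¹]) : A⟦X⟧ :=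
  PowerSeries.mk fun n => ∑ e ∈ p.coeff.support.finsuppAntidiag n,
    ((p.coeff.support.sort (· ≤ ·)).map (fun i => p.coeff i ^ e i • g i (e i))).prod

variable {g}

section Comm

variable {B : Type*} [CommRing B] [Algebra K B] (f : B →ₐ[K] A) {gB : ℤ → ℕ → B}

/-- Identities for the ordered products can thus be proved in a commutative algebra, where unordered
products are available. -/
lemma familySeries_eq_map (hg : ∀ r k, f (gB r k) = g r k) (p : K[T;T⁻¹]) :
    familySeries g p = PowerSeries.map (f : B →+* A)
      (p.coeff.prod fun i c => PowerSeries.mk fun k => c ^ k • gB i k) := by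
  ext n
  rw [coeff_map, Finsupp.prod, coeff_prod, map_sum, familySeries, coeff_mk]
  refine Finset.sum_congr rfl fun e _ => ?_
  have h : ∏ i ∈ p.coeff.support, coeff (e i) (PowerSeries.mk fun k => p.coeff i ^ k • gB i k) =
      ((p.coeff.support.sort (· ≤ ·)).map fun i => p.coeff i ^ e i • gB i (e i)).prod := by
    simp only [coeff_mk]
    rw [← Multiset.prod_coe, ← Multiset.map_coe, Finset.sort_eq]
    rfl
  rw [h, map_list_prod, List.map_map]
  congr 1
  refine List.map_congr_left fun i _ => ?_
  simp [hg]

end Comm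

/-- The properties of a family of divided powers of commuting elements. -/
structure IsDividedFamily (g : ℤ → ℕ → A) : Prop where
  zero : ∀ r, g r 0 = 1
  mul : ∀ r i j, g r i * g r j = ((i + j).choose i) • g r (i + j)
  comm : ∀ r s i j, Commute (g r i) (g s j)

lemma IsDividedFamily.exists_comm (h : IsDividedFamily g) :
    ∃ (B : Type u) (_ : CommRing B) (_ : Algebra K B) (f : B →ₐ[K] A) (gB : ℤ → ℕ → B),
      (∀ r k, f (gB r k) = g r k) ∧ IsDividedFamily gB := by
  let s : Set A := Set.range fun x : ℤ × ℕ => g x.1 x.2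
  have hs : ∀ a ∈ s, ∀ b ∈ s, a * b = b * a := by
    rintro _ ⟨x, rfl⟩ _ ⟨y, rfl⟩
    exact h.comm _ _ _ _
  have := Algebra.isMulCommutative_adjoin K hs
  refine ⟨Algebra.adjoin K s,
    { (inferInstance : Ring (Algebra.adjoin K s)) with mul_comm := this.is_comm.comm }, (Algebra.adjoin K s).algebra,
    (Algebra.adjoin K s).val, fun r k => ⟨g r k, Algebra.subset_adjoin ⟨(r, k), rfl⟩⟩,
    fun _ _ => rfl, ⟨fun r => Subtype.ext (h.zero r), fun r i j => Subtype.ext (h.mul r i j),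
    fun r t i j => show _ * _ = _ * _ from Subtype.ext (h.comm r t i j).eq⟩⟩

/-- The binomial theorem, with the binomial coefficients supplied by the products of divided powers;
nothing is divided in `K`. -/
lemma IsDividedFamily.mk_mul_mk (h : IsDividedFamily g) (r : ℤ) (c d : K) :
    (PowerSeries.mk fun k => c ^ k • g r k) * (PowerSeries.mk fun k => d ^ k • g r k) =
      PowerSeries.mk fun k => (c + d) ^ k • g r k := by
  ext n
  rw [coeff_mul]
  simp only [coeff_mk]
  rw [(Commute.all c d).add_pow', Finset.sum_smul]
  refine Finset.sum_congr rfl fun p hp => ?_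
  rw [Finset.HasAntidiagonal.mem_antidiagonal] at hp
  rw [smul_mul_smul_comm, h.mul, hp, smul_comm, smul_assoc]

/-- Exponent by exponent this is `mk_mul_mk`, and it remains true when terms of `p` and `q` cancel.
-/
lemma IsDividedFamily.familySeries_add (h : IsDividedFamily g) (p q : K[T;T⁻¹]) :
    familySeries g (p + q) = familySeries g p * familySeries g q := by
  obtain ⟨B, _, _, f, gB, hf, hB⟩ := h.exists_comm (K := K)
  simp only [familySeries_eq_map f hf]
  rw [← map_mul, AddMonoidAlgebra.coeff_add, Finsupp.prod_add_index']
  · intro r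
    ext k
    rcases k with _ | k
    · simp [hB.zero]
    · simp [coeff_one]
  · intro r c d
    exact (hB.mk_mul_mk r c d).symm

lemma IsDividedFamily.familySeries_C_mul_T (h : IsDividedFamily g) (c : K) (r : ℤ) :
    familySeries g (LaurentPolynomial.C c * LaurentPolynomial.T r) =
      PowerSeries.mk fun k => c ^ k • g r k := by
  obtain ⟨B, _, _, f, gB, hf, hB⟩ := h.exists_comm (K := K)
  rw [familySeries_eq_map f hf, ← LaurentPolynomial.single_eq_C_mul_T,
    AddMonoidAlgebra.coeff_single, Finsupp.prod_single_index]
  · ext k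
    simp [hf]
  · ext k
    rcases k with _ | k
    · simp [hB.zero]
    · simp [coeff_one]

end Family

section Enveloping

variable {M : Type*} [LieRing M] [LieAlgebra ℂ M]

attribute [local instance] LieRing.ofAssociativeRing

lemma ι_mul_ι (x y : M) :
    UniversalEnvelopingAlgebra.ι ℂ x * UniversalEnvelopingAlgebra.ι ℂ y =
      UniversalEnvelopingAlgebra.ι ℂ y * UniversalEnvelopingAlgebra.ι ℂ x +
        UniversalEnvelopingAlgebra.ι ℂ ⁅x, y⁆ := by
  rw [LieHom.map_lie, LieRing.of_associative_ring_bracket]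
  abel

lemma ι_zero : UniversalEnvelopingAlgebra.ι ℂ (0 : M) = 0 :=
  map_zero (UniversalEnvelopingAlgebra.ι ℂ (L := M))

lemma ι_add (x y : M) : UniversalEnvelopingAlgebra.ι ℂ (x + y) =
    UniversalEnvelopingAlgebra.ι ℂ x + UniversalEnvelopingAlgebra.ι ℂ y :=
  map_add (UniversalEnvelopingAlgebra.ι ℂ (L := M)) x y

lemma ι_smul (c : ℂ) (x : M) :
    UniversalEnvelopingAlgebra.ι ℂ (c • x) = c • UniversalEnvelopingAlgebra.ι ℂ x :=
  map_smul (UniversalEnvelopingAlgebra.ι ℂ (L := M)) c x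

end Enveloping

section Monom

variable {L : Type*} [LieRing L] [LieAlgebra ℂ L]

lemma ι_monom_mul (x y : L) (r s : ℤ) :
    UniversalEnvelopingAlgebra.ι ℂ (monom x r) * UniversalEnvelopingAlgebra.ι ℂ (monom y s) =
      UniversalEnvelopingAlgebra.ι ℂ (monom y s) * UniversalEnvelopingAlgebra.ι ℂ (monom x r) +
        UniversalEnvelopingAlgebra.ι ℂ (monom ⁅x, y⁆ (r + s)) := by
  rw [ι_mul_ι, monom_lie]

lemma monom_zero (r : ℤ) : monom (0 : L) r = 0 := TensorProduct.tmul_zero _ _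

lemma commute_ι_monom {x y : L} (h : ⁅x, y⁆ = 0) (r s : ℤ) :
    Commute (UniversalEnvelopingAlgebra.ι ℂ (monom x r))
      (UniversalEnvelopingAlgebra.ι ℂ (monom y s)) := by
  rw [Commute, SemiconjBy, ι_monom_mul, h, monom_zero, ι_zero, add_zero]

end Monom

/-! ### Generating series in the hyper loop algebra and their commutation. -/

section Hyper

open LieAlgebra LieAlgebra.IsKilling PowerSeries

variable {L : Type*} [LieRing L] [LieAlgebra ℂ L] [IsKilling ℂ L] [FiniteDimensional ℂ L]
  {H : LieSubalgebra ℂ L} [H.IsCartanSubalgebra] (C : ChevalleyBasis H)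
  {F : Type*} [Field F]

lemma commute_loopGen {α β : H.root} (h : ⁅C.x α, C.x β⁆ = 0) (r s : ℤ) (i j : ℕ) :
    Commute (loopGen C α r i) (loopGen C β s j) :=
  commute_divPow (commute_ι_monom h r s) i j

/-- The divided power `(x α ⊗ t ^ r) ^ (k)` as an element of the integral form. -/
def formGen (α : H.root) (r : ℤ) (k : ℕ) : loopForm C :=
  ⟨loopGen C α r k, Algebra.subset_adjoin ⟨α, r, k, rfl⟩⟩

variable (F) in
/-- The reduction `U_ℤ(g̃) → U_F(g̃)`. -/
def formToHyper : loopForm C →+* HyperLoop C F :=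
  (Algebra.TensorProduct.includeRight : loopForm C →ₐ[ℤ] HyperLoop C F).toRingHom

lemma formToHyper_formGen (α : H.root) (r : ℤ) (k : ℕ) :
    formToHyper C F (formGen C α r k) = hyperGen C F α r k := rfl

lemma commute_hyperGen {α β : H.root} (h : ⁅C.x α, C.x β⁆ = 0) (r s : ℤ) (i j : ℕ) :
    Commute (hyperGen C F α r i) (hyperGen C F β s j) := by
  have h1 : Commute (formGen C α r i) (formGen C β s j) :=
    Subtype.ext (commute_loopGen C h r s i j)
  exact h1.map (formToHyper C F)

lemma isDividedFamily_hyperGen (α : H.root) : IsDividedFamily (hyperGen C F α) where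
  zero r := by
    have h1 : formGen C α r 0 = 1 := Subtype.ext (divPow_zero _)
    rw [← formToHyper_formGen, h1, map_one]
  mul r i j := by
    have h1 : formGen C α r i * formGen C α r j = ((i + j).choose i) • formGen C α r (i + j) :=
      Subtype.ext (divPow_mul_divPow _ i j)
    rw [← formToHyper_formGen, ← formToHyper_formGen, ← formToHyper_formGen, ← map_mul, h1,
      map_nsmul]
  comm r s i j := commute_hyperGen C (lie_self _) r s i j

/-- The generating series of the divided powers `(x α ⊗ p) ^ (k)`. -/
def hyperSeries (α : H.root) (p : F[T;T⁻¹]) : (HyperLoop C F)⟦X⟧ :=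
  PowerSeries.mk (hyperDivPow C α p)

lemma hyperSeries_add (α : H.root) (p q : F[T;T⁻¹]) :
    hyperSeries C α (p + q) = hyperSeries C α p * hyperSeries C α q :=
  (isDividedFamily_hyperGen C α).familySeries_add p q

lemma hyperSeries_C_mul_T (α : H.root) (c : F) (r : ℤ) :
    hyperSeries C α (LaurentPolynomial.C c * LaurentPolynomial.T r) =
      PowerSeries.mk fun k => c ^ k • hyperGen C F α r k :=
  (isDividedFamily_hyperGen C α).familySeries_C_mul_T c r

lemma hyperSeries_zero (α : H.root) : hyperSeries C α (0 : F[T;T⁻¹]) = 1 := by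
  have h := hyperSeries_C_mul_T C α (0 : F) 0
  rw [map_zero, zero_mul] at h
  rw [h]
  ext k
  rcases k with _ | k
  · simp [(isDividedFamily_hyperGen C α).zero]
  · simp [coeff_one]

lemma hyperSeries_neg_mul (α : H.root) (p : F[T;T⁻¹]) :
    hyperSeries C α (-p) * hyperSeries C α p = 1 := by
  rw [← hyperSeries_add, neg_add_cancel, hyperSeries_zero]

lemma hyperSeries_mul_neg (α : H.root) (p : F[T;T⁻¹]) :
    hyperSeries C α p * hyperSeries C α (-p) = 1 := by
  rw [← hyperSeries_add, add_neg_cancel, hyperSeries_zero]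

/-- Induction for multiplicative families of power series indexed by Laurent polynomials. -/
lemma laurent_induction {P : F[T;T⁻¹] → Prop}
    (hT : ∀ c r, P (LaurentPolynomial.C c * LaurentPolynomial.T r))
    (hadd : ∀ p q, P p → P q → P (p + q)) (p : F[T;T⁻¹]) : P p :=
  LaurentPolynomial.induction_on' p hadd (fun n a => hT a n)

lemma coeff_hyperSeries_smul (α : H.root) (c : F) (p : F[T;T⁻¹]) (k : ℕ) :
    coeff k (hyperSeries C α (c • p)) = c ^ k • coeff k (hyperSeries C α p) := by
  induction p using laurent_induction generalizing k with
  | hT d r =>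
    rw [LaurentPolynomial.smul_eq_C_mul, ← mul_assoc, ← map_mul, hyperSeries_C_mul_T,
      hyperSeries_C_mul_T, coeff_mk, coeff_mk, mul_pow, mul_smul]
  | hadd p q hp hq =>
    rw [smul_add, hyperSeries_add, hyperSeries_add, coeff_mul, coeff_mul, Finset.smul_sum]
    refine Finset.sum_congr rfl fun x hx => ?_
    rw [Finset.HasAntidiagonal.mem_antidiagonal] at hx
    rw [hp, hq, smul_mul_smul_comm, ← pow_add, hx]

lemma commute_coeff_hyperSeries {α β : H.root} (h : ⁅C.x α, C.x β⁆ = 0) (p q : F[T;T⁻¹])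
    (i j : ℕ) : Commute (coeff i (hyperSeries C α p)) (coeff j (hyperSeries C β q)) := by
  have key : ∀ (c : F) r (q : F[T;T⁻¹]) i j,
      Commute (c • hyperGen C F α r i) (coeff j (hyperSeries C β q)) := by
    intro c r q
    induction q using laurent_induction with
    | hT d s =>
      intro i j
      rw [hyperSeries_C_mul_T, coeff_mk]
      exact ((commute_hyperGen C h r s i j).smul_left _).smul_right _
    | hadd p q hp hq =>
      intro i j
      rw [hyperSeries_add, coeff_mul]
      exact Commute.sum_right _ _ _ fun x _ => (hp i _).mul_right (hq i _)
  induction p using laurent_induction generalizing i j with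
  | hT c r =>
    rw [hyperSeries_C_mul_T, coeff_mk]
    exact key _ r q i j
  | hadd p p' hp hp' =>
    rw [hyperSeries_add, coeff_mul]
    exact Commute.sum_left _ _ _ fun x _ => (hp _ j).mul_left (hp' _ j)

lemma commute_hyperSeries {α β : H.root} (h : ⁅C.x α, C.x β⁆ = 0) (p q : F[T;T⁻¹]) :
    Commute (hyperSeries C α p) (hyperSeries C β q) :=
  commute_of_coeff fun i j => commute_coeff_hyperSeries C h p q i j

/-- The commutation relation for root vectors generating a Heisenberg algebra. -/
lemma hyperSeries_exchange {α β γ : H.root} {κ : ℤ} (h : ⁅C.x α, C.x β⁆ = κ • C.x γ)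
    (hα : ⁅C.x α, C.x γ⁆ = 0) (hβ : ⁅C.x β, C.x γ⁆ = 0) (p q : F[T;T⁻¹]) :
    hyperSeries C α p * hyperSeries C β q =
      sqSubst (hyperSeries C γ ((κ : F) • (p * q))) *
        (hyperSeries C β q * hyperSeries C α p) := by
  have hcα : ∀ p q : F[T;T⁻¹], hyperSeries C α p * sqSubst (hyperSeries C γ q) =
      sqSubst (hyperSeries C γ q) * hyperSeries C α p := fun p q =>
    (commute_sqSubst fun i j => commute_coeff_hyperSeries C hα p q i j).eq
  have hcβ : ∀ p q : F[T;T⁻¹], hyperSeries C β p * sqSubst (hyperSeries C γ q) =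
      sqSubst (hyperSeries C γ q) * hyperSeries C β p := fun p q =>
    (commute_sqSubst fun i j => commute_coeff_hyperSeries C hβ p q i j).eq
  induction p using laurent_induction with
  | hT c r =>
    induction q using laurent_induction with
    | hT d s =>
      have e : (κ : F) • (LaurentPolynomial.C c * LaurentPolynomial.T r *
          (LaurentPolynomial.C d * LaurentPolynomial.T s)) =
          LaurentPolynomial.C (κ * (c * d)) * LaurentPolynomial.T (r + s) := by
        rw [LaurentPolynomial.smul_eq_C_mul, map_mul, map_mul, LaurentPolynomial.T_add]
        ring
      rw [e, hyperSeries_C_mul_T, hyperSeries_C_mul_T, hyperSeries_C_mul_T]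
      refine mk_mul_mk_of_exchange fun i j => ?_
      -- The identity is proved in the integral form, inside characteristic zero, and then reduced
      -- to `F`, where factorials may vanish.
      have h1 : formGen C α r i * formGen C β s j = ∑ p ∈ Finset.HasAntidiagonal.antidiagonal j,
          if p.1 ≤ i then κ ^ p.1 • formGen C γ (r + s) p.1 * formGen C β s p.2 *
            formGen C α r (i - p.1) else 0 := by
        have h2 := divPow_mul_divPow_of_heisenberg (ι_monom_mul (C.x α) (C.x β) r s)
          (commute_ι_monom (by rw [h, lie_zsmul, hα, smul_zero]) _ _)
          (commute_ι_monom (by rw [h, lie_zsmul, hβ, smul_zero]) _ _) i j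
        have h3 : ∀ k, divPow (UniversalEnvelopingAlgebra.ι ℂ (monom ⁅C.x α, C.x β⁆ (r + s))) k =
            κ ^ k • loopGen C γ (r + s) k := by
          intro k
          rw [h, ← Int.cast_smul_eq_zsmul ℂ, monom_smul, ι_smul, divPow_smul,
            ← Int.cast_pow, Int.cast_smul_eq_zsmul]
          rfl
        apply Subtype.ext
        refine h2.trans ?_
        rw [AddSubmonoidClass.coe_finsetSum]
        refine Finset.sum_congr rfl fun p _ => ?_
        split_ifs
        · rw [h3]; rfl
        · rfl
      have h4 := congrArg (formToHyper C F) h1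
      rw [map_mul, map_sum, formToHyper_formGen, formToHyper_formGen] at h4
      rw [smul_mul_smul_comm, h4, Finset.smul_sum]
      refine Finset.sum_congr rfl fun p hp => ?_
      rw [Finset.HasAntidiagonal.mem_antidiagonal] at hp
      split_ifs with hi
      · rw [map_mul, map_mul, map_zsmul, formToHyper_formGen, formToHyper_formGen,
          formToHyper_formGen, ← Int.cast_smul_eq_zsmul F]
        simp only [smul_mul_assoc, mul_smul_comm, smul_smul]
        congr 1
        obtain ⟨e, rfl⟩ := Nat.exists_eq_add_of_le hi
        rw [← hp, Nat.add_sub_cancel_left]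
        push_cast
        ring
      · rw [map_zero, smul_zero]
    | hadd q q' hq hq' =>
      -- The `γ`-series commute with the `β`-series, so the corrections for `q` and `q'` gather in
      -- front and multiply to the one for `q + q'`.
      rw [hyperSeries_add C β, ← mul_assoc, hq, mul_assoc _ _ (hyperSeries C β q'),
        mul_assoc _ _ (hyperSeries C β q'), hq', ← mul_assoc (hyperSeries C β q), hcβ, mul_add,
        smul_add, hyperSeries_add C γ, sqSubst_mul]
      simp only [mul_assoc]
  | hadd p p' hp hp' =>
    rw [hyperSeries_add C α, mul_assoc, hp', ← mul_assoc, hcα, mul_assoc,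
      ← mul_assoc (hyperSeries C α p), hp, add_mul, smul_add, hyperSeries_add C γ, sqSubst_mul]
    have hc : sqSubst (hyperSeries C γ ((κ : F) • (p * q))) *
        sqSubst (hyperSeries C γ ((κ : F) • (p' * q))) =
        sqSubst (hyperSeries C γ ((κ : F) • (p' * q))) *
        sqSubst (hyperSeries C γ ((κ : F) • (p * q))) := by
      rw [← sqSubst_mul, ← sqSubst_mul, (commute_hyperSeries C (lie_self _) _ _).eq]
    rw [hc]
    simp only [mul_assoc]

end Hyper

section Loop

variable {L : Type*} [LieRing L] [LieAlgebra ℂ L]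

lemma commute_smul_ι_monom {x y : L} (h : ⁅x, y⁆ = 0) (r s : ℤ) (c d : ℂ) :
    Commute (c • UniversalEnvelopingAlgebra.ι ℂ (monom x r))
      (d • UniversalEnvelopingAlgebra.ι ℂ (monom y s)) :=
  ((commute_ι_monom h r s).smul_left c).smul_right d

end Loop

/-! ### Factorization of the twisted exponentials, and the induced homomorphism. -/

section Twisted

open LieAlgebra LieAlgebra.IsKilling PowerSeries

variable {L : Type*} [LieRing L] [LieAlgebra ℂ L] [IsKilling ℂ L] [FiniteDimensional ℂ L]
  {H : LieSubalgebra ℂ L} [H.IsCartanSubalgebra]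
  {b : (rootSystem H).Base} {C : ChevalleyBasis H} (σ : DiagramAut b C)
  {F : Type*} [Field F] {ζ : ℂˣ}

/-- `√2` as an element of `ℤ[ζ, √2]`. -/
def sqrtTwo (ζ : ℂˣ) : coeffRing ζ :=
  ⟨((√2 : ℝ) : ℂ), Algebra.subset_adjoin (by simp)⟩

lemma sqrtTwo_mul_self (ζ : ℂˣ) : sqrtTwo ζ * sqrtTwo ζ = 2 := by
  apply Subtype.ext
  change ((√2 : ℝ) : ℂ) * ((√2 : ℝ) : ℂ) = 2
  rw [← Complex.ofReal_mul, Real.mul_self_sqrt (by norm_num)]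
  norm_num

/-- `ζ` as a unit of `ℤ[ζ, √2]`. -/
def zetaUnit {m : ℕ} (hm : m ≠ 0) (hζ : ζ ^ m = 1) : (coeffRing ζ)ˣ :=
  Units.ofPowEqOne (⟨(ζ : ℂ), Algebra.subset_adjoin (by simp)⟩ : coeffRing ζ) m
    (Subtype.ext (by simpa using congrArg Units.val hζ)) hm

lemma coe_zetaUnit_zpow {m : ℕ} (hm : m ≠ 0) (hζ : ζ ^ m = 1) (r : ℤ) :
    (((zetaUnit hm hζ ^ r : (coeffRing ζ)ˣ) : coeffRing ζ) : ℂ) = ((ζ ^ r : ℂˣ) : ℂ) := by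
  have h : Units.map ((coeffRing ζ).val : coeffRing ζ →* ℂ) (zetaUnit hm hζ) = ζ := by
    ext; rfl
  have h2 := congrArg (fun u : ℂˣ => (u : ℂ)) ((map_zpow (Units.map
    ((coeffRing ζ).val : coeffRing ζ →* ℂ)) (zetaUnit hm hζ) r).trans (congrArg (· ^ r) h))
  exact h2

variable (C) in
/-- The power series `∑ c ^ k ⊗ (x α ⊗ t ^ r) ^ (k) X ^ k` over `ℤ[ζ, √2] ⊗ U_ℤ(g̃)`. -/
def formSeries (α : H.root) (r : ℤ) (c : coeffRing ζ) : ((coeffRing ζ) ⊗[ℤ] (loopForm C))⟦X⟧ :=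
  PowerSeries.mk fun k => (c ^ k) ⊗ₜ[ℤ] formGen C α r k

lemma map_coeffMul_formSeries (α : H.root) (r : ℤ) (c : coeffRing ζ) :
    PowerSeries.map (coeffMul C ζ : _ →+* _) (formSeries C α r c) =
      expSeries ((c : ℂ) • UniversalEnvelopingAlgebra.ι ℂ (monom (C.x α) r)) := by
  ext k
  rw [coeff_map, formSeries, coeff_mk, coeff_expSeries, divPow_smul, Algebra.smul_def]
  have h : coeffMul C ζ ((c ^ k) ⊗ₜ[ℤ] formGen C α r k) =
      algebraMap ℂ _ ((c ^ k : coeffRing ζ) : ℂ) * (formGen C α r k : _) :=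
    Algebra.TensorProduct.lift_tmul _ _ _ _ _
  exact h

lemma map_coeffReduce_formSeries (χ : coeffRing ζ →+* F) (α : H.root) (r : ℤ) (c : coeffRing ζ) :
    PowerSeries.map (coeffReduce C χ : _ →+* _) (formSeries C α r c) =
      hyperSeries C α (LaurentPolynomial.C (χ c) * LaurentPolynomial.T r) := by
  ext k
  rw [coeff_map, formSeries, coeff_mk, hyperSeries_C_mul_T, coeff_mk, hyperGen,
    TensorProduct.smul_tmul', smul_eq_mul, mul_one, ← map_pow]
  exact (Algebra.TensorProduct.map_tmul _ _ _ _)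

/-- `W` is a lift to `ℤ[ζ, √2] ⊗ U_ℤ(g̃)` of the series of divided powers of
`x_{β, -r} ⊗ t ^ r`. -/
def IsLift (β : H.root) (r : ℤ) (W : ((coeffRing ζ) ⊗[ℤ] (loopForm C))⟦X⟧) : Prop :=
  PowerSeries.map (coeffMul C ζ : _ →+* _) W =
    expSeries (UniversalEnvelopingAlgebra.ι ℂ (monom (twistedVec σ ζ β (-r)) r))

variable {σ}

lemma isLift_of_perm_eq {β : H.root} {r : ℤ} (hβ : σ.perm β = β)
    (h : σ.toLieEquiv (C.x β) = ((ζ ^ (-r) : ℂˣ) : ℂ) • C.x β) :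
    IsLift σ β r (formSeries (ζ := ζ) C β r 1) := by
  rw [IsLift, map_coeffMul_formSeries, twistedVec, if_pos hβ, if_pos h]
  simp

lemma isLift_one_of_perm_eq {β : H.root} {r : ℤ} (hβ : σ.perm β = β)
    (h : ¬ σ.toLieEquiv (C.x β) = ((ζ ^ (-r) : ℂˣ) : ℂ) • C.x β) :
    IsLift (ζ := ζ) σ β r 1 := by
  rw [IsLift, map_one, twistedVec, if_pos hβ, if_neg h, monom_zero, ι_zero]
  ext k
  rw [coeff_expSeries, coeff_one]
  split_ifs with hk
  · rw [hk, divPow_zero]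
  · rw [divPow_zero_left _ hk]

variable (hσ : σ.order ≠ 0) (hζ : ζ ^ σ.order = 1)

/-- The two root vectors commute, so the exponential of their sum factors. With `ε = -r` the weight
`ζ^(-jε)` at `j = 1` is `ζ^r`. -/
lemma isLift_of_order_eq_two (h2 : σ.order = 2) {β : H.root} (r : ℤ) (hβ : σ.perm β ≠ β)
    (h : (rootSystem H).root β + (rootSystem H).root (σ.perm β) ∉
      Set.range (rootSystem H).root) :
    IsLift σ β r (formSeries C β r 1 * formSeries C (σ.perm β) r
      (((σ.sign β : ℤ) : coeffRing ζ) * ((zetaUnit hσ hζ ^ r : (coeffRing ζ)ˣ) : coeffRing ζ))) := by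
  rw [IsLift, map_mul, map_coeffMul_formSeries, map_coeffMul_formSeries,
    ← expSeries_add (commute_smul_ι_monom (σ.lie_perm_eq_zero h) _ _ _ _)]
  congr 1
  rw [twistedVec, if_neg hβ, if_neg (by rintro ⟨γ, hγ⟩; exact h ⟨γ, hγ⟩),
    congrArg Finset.range h2,
    Finset.sum_range_succ, Finset.sum_range_one, one_smul, monom_add, ι_add]
  congr 1
  · simp
  · rw [Function.iterate_one, σ.toLieEquiv_x, ← Int.cast_smul_eq_zsmul ℂ, monom_smul, monom_smul,
      ι_smul, ι_smul, smul_smul]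
    congr 1
    push_cast
    rw [coe_zetaUnit_zpow, mul_comm]
    simp

lemma exists_lie_perm_eq {β γ : H.root}
    (hγ : (rootSystem H).root γ = (rootSystem H).root β + (rootSystem H).root (σ.perm β)) :
    ∃ κ : ℤ, ⁅C.x β, C.x (σ.perm β)⁆ = κ • C.x γ := by
  rcases C.lie_add _ _ _ hγ with h | h
  · exact ⟨_, h.trans (natCast_zsmul _ _).symm⟩
  · exact ⟨-((_ : ℕ) : ℤ), by rw [h, neg_smul, natCast_zsmul]⟩

/-- The commutator of the two summands carries `√2 · √2 = 2`, so it is `-2w` with `w` having a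
coefficient in `ℤ[ζ, √2]`, as `expSeries_add_of_heisenberg` requires. -/
lemma isLift_of_root_add (h2 : σ.order = 2) {β γ : H.root} (r : ℤ) (hβ : σ.perm β ≠ β)
    (hγ : (rootSystem H).root γ = (rootSystem H).root β + (rootSystem H).root (σ.perm β))
    {κ : ℤ} (hκ : ⁅C.x β, C.x (σ.perm β)⁆ = κ • C.x γ) :
    IsLift σ β r (formSeries C β r (sqrtTwo ζ) * formSeries C (σ.perm β) r
      (sqrtTwo ζ * (((σ.sign β : ℤ) : coeffRing ζ) * ((zetaUnit hσ hζ ^ r : (coeffRing ζ)ˣ) : coeffRing ζ))) *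
      sqSubst (formSeries C γ (r + r)
        (-(((κ : ℤ) : coeffRing ζ) * (((σ.sign β : ℤ) : coeffRing ζ) * ((zetaUnit hσ hζ ^ r : (coeffRing ζ)ˣ) : coeffRing ζ)))))) := by
  rw [IsLift, map_mul, map_mul, map_sqSubst, map_coeffMul_formSeries, map_coeffMul_formSeries,
    map_coeffMul_formSeries, ← expSeries_add_of_heisenberg]
  · congr 1
    rw [twistedVec, if_neg hβ, if_pos ⟨γ, hγ⟩, congrArg Finset.range h2, Finset.sum_range_succ, Finset.sum_range_one,
      smul_add, monom_add, ι_add]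
    congr 1
    · rw [Function.iterate_zero, id, Nat.cast_zero, neg_zero, zero_mul, zpow_zero, Units.val_one,
        one_smul, monom_smul, ι_smul]
      rfl
    · rw [Function.iterate_one, σ.toLieEquiv_x, ← Int.cast_smul_eq_zsmul ℂ, monom_smul, monom_smul,
        monom_smul, ι_smul, ι_smul, ι_smul, smul_smul, smul_smul]
      congr 1
      push_cast
      rw [coe_zetaUnit_zpow]
      simp [sqrtTwo]
      ring
  · have h : (sqrtTwo ζ : ℂ) * sqrtTwo ζ = 2 :=
      congrArg (fun c : coeffRing ζ => (c : ℂ)) (sqrtTwo_mul_self ζ)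
    push_cast
    rw [smul_mul_smul_comm, smul_mul_smul_comm, ι_monom_mul, hκ, ← Int.cast_smul_eq_zsmul ℂ,
      monom_smul, ι_smul, smul_add, smul_smul, smul_smul]
    congr 2
    · ring
    · linear_combination (κ : ℂ) * (((σ.sign β : ℤ) : ℂ) *
        (((zetaUnit hσ hζ ^ r : (coeffRing ζ)ˣ) : coeffRing ζ) : ℂ)) * h
  · exact commute_smul_ι_monom (σ.lie_add_perm_eq_zero h2 hβ hγ) _ _ _ _
  · exact commute_smul_ι_monom (σ.lie_perm_add_perm_eq_zero h2 hβ hγ) _ _ _ _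

lemma lie_perm_eq_zero_of_order_eq_three (h3 : σ.order = 3) {β : H.root} (hβ : σ.perm β ≠ β) :
    ⁅C.x β, C.x (σ.perm β)⁆ = 0 ∧ ⁅C.x (σ.perm β), C.x (σ.perm (σ.perm β))⁆ = 0 ∧
      ⁅C.x β, C.x (σ.perm (σ.perm β))⁆ = 0 := by
  have h := σ.perm_iterate_order β
  simp only [h3, Function.iterate_succ_apply', Function.iterate_zero, id] at h
  have key : ∀ {α : H.root}, σ.perm α ≠ α → ⁅C.x α, C.x (σ.perm α)⁆ = 0 := fun hα =>
    σ.lie_perm_eq_zero (σ.root_add_perm_notMem_of_order_eq_three h3 hα)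
  have hβ2 : σ.perm (σ.perm β) ≠ σ.perm β := σ.perm.injective.ne hβ
  have hβ3 : σ.perm (σ.perm (σ.perm β)) ≠ σ.perm (σ.perm β) := σ.perm.injective.ne hβ2
  refine ⟨key hβ, key hβ2, ?_⟩
  have h4 := key hβ3
  rw [h] at h4
  rw [← lie_skew, h4, neg_zero]

lemma isLift_of_order_eq_three (h3 : σ.order = 3) {β : H.root} (r : ℤ) (hβ : σ.perm β ≠ β) :
    IsLift σ β r (formSeries C β r 1 * formSeries C (σ.perm β) r
      (((σ.sign β : ℤ) : coeffRing ζ) * ((zetaUnit hσ hζ ^ r : (coeffRing ζ)ˣ) : coeffRing ζ)) *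
      formSeries C (σ.perm (σ.perm β)) r
      ((((σ.sign β * σ.sign (σ.perm β) : ℤˣ) : ℤ) : coeffRing ζ) *
        ((zetaUnit hσ hζ ^ (2 * r) : (coeffRing ζ)ˣ) : coeffRing ζ))) := by
  obtain ⟨c1, c2, c3⟩ := lie_perm_eq_zero_of_order_eq_three h3 hβ
  have h := σ.root_add_perm_notMem_of_order_eq_three h3 hβ
  rw [IsLift, map_mul, map_mul, map_coeffMul_formSeries, map_coeffMul_formSeries,
    map_coeffMul_formSeries, ← expSeries_add (commute_smul_ι_monom c1 _ _ _ _),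
    ← expSeries_add ((commute_smul_ι_monom c3 _ _ _ _).add_left (commute_smul_ι_monom c2 _ _ _ _))]
  congr 1
  rw [twistedVec, if_neg hβ, if_neg (by rintro ⟨γ, hγ⟩; exact h ⟨γ, hγ⟩),
    congrArg Finset.range h3,
    Finset.sum_range_succ, Finset.sum_range_succ, Finset.sum_range_one, one_smul, monom_add, ι_add,
    monom_add, ι_add]
  congr 1
  · congr 1
    · simp
    · rw [Function.iterate_one, σ.toLieEquiv_x, ← Int.cast_smul_eq_zsmul ℂ, monom_smul, monom_smul,
        ι_smul, ι_smul, smul_smul]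
      congr 1
      push_cast
      rw [coe_zetaUnit_zpow, mul_comm]
      simp
  · rw [Function.iterate_succ_apply', Function.iterate_one, σ.toLieEquiv_x, map_zsmul,
      σ.toLieEquiv_x, smul_smul, ← Units.val_mul, ← Int.cast_smul_eq_zsmul ℂ, monom_smul,
      monom_smul, ι_smul, ι_smul, smul_smul]
    congr 1
    push_cast
    rw [coe_zetaUnit_zpow, mul_comm]
    simp

include hσ hζ in
lemma exists_isLift (hm : σ.order ∈ ({1, 2, 3} : Set ℕ)) (β : H.root) (r : ℤ) :
    ∃ W, IsLift (ζ := ζ) σ β r W := by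
  by_cases hβ : σ.perm β = β
  · by_cases h : σ.toLieEquiv (C.x β) = ((ζ ^ (-r) : ℂˣ) : ℂ) • C.x β
    · exact ⟨_, isLift_of_perm_eq hβ h⟩
    · exact ⟨_, isLift_one_of_perm_eq hβ h⟩
  rcases hm with h1 | h2 | h3
  · exact absurd (by simpa [h1] using σ.perm_iterate_order β) hβ
  · by_cases h : (rootSystem H).root β + (rootSystem H).root (σ.perm β) ∈
      Set.range (rootSystem H).root
    · obtain ⟨γ, hγ⟩ := h
      obtain ⟨κ, hκ⟩ := exists_lie_perm_eq hγ
      exact ⟨_, isLift_of_root_add hσ hζ h2 r hβ hγ hκ⟩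
    · exact ⟨_, isLift_of_order_eq_two hσ hζ h2 r hβ h⟩
  · exact ⟨_, isLift_of_order_eq_three hσ hζ h3 r hβ⟩

include hζ in
lemma toLieEquiv_twistedVec (β : H.root) (ε : ℤ) :
    σ.toLieEquiv (twistedVec σ ζ β ε) = ((ζ ^ ε : ℂˣ) : ℂ) • twistedVec σ ζ β ε := by
  have hsm : ∀ (c : ℂ) (x : L), σ.toLieEquiv (c • x) = c • σ.toLieEquiv x := fun c x =>
    σ.toLieEquiv.toLinearEquiv.map_smul c x
  rw [twistedVec]
  by_cases hβ : σ.perm β = β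
  · rw [if_pos hβ]
    split_ifs with h
    · exact h
    · rw [map_zero, smul_zero]
  · rw [if_neg hβ, hsm, map_sum, smul_comm]
    congr 1
    rw [Finset.smul_sum]
    -- The sum over `m + 1` indices is split at either end; its first and last terms agree because
    -- `σ^m = 1` and `ζ^m = 1`, so the cyclic shift leaves the sum unchanged.
    have hs := (Finset.sum_range_succ (fun j : ℕ => ((ζ ^ ε : ℂˣ) : ℂ) •
      ((ζ ^ (-(j : ℤ) * ε) : ℂˣ) : ℂ) • (σ.toLieEquiv)^[j] (C.x β)) σ.order).symm.trans
      (Finset.sum_range_succ' _ _)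
    have h0 : ((ζ ^ (-(σ.order : ℤ) * ε) : ℂˣ) : ℂ) • (σ.toLieEquiv)^[σ.order] (C.x β) =
        ((ζ ^ (-((0 : ℕ) : ℤ) * ε) : ℂˣ) : ℂ) • (σ.toLieEquiv)^[0] (C.x β) := by
      rw [σ.iterate_order, zpow_mul, zpow_neg, zpow_natCast, hζ]
      simp
    rw [h0] at hs
    rw [add_right_cancel hs]
    refine Finset.sum_congr rfl fun j _ => ?_
    rw [hsm, smul_smul, ← Units.val_mul, ← zpow_add, Function.iterate_succ_apply']
    congr 3
    push_cast
    ring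

include hζ in
lemma monom_twistedVec_mem (β : H.root) (r : ℤ) :
    monom (twistedVec σ ζ β (-r)) r ∈ twistedLoop σ.toLieEquiv ζ := by
  change loopTwist σ.toLieEquiv ζ _ = _
  rw [loopTwist_monom, toLieEquiv_twistedVec hζ, monom_smul, smul_smul, ← Units.val_mul,
    ← zpow_add, add_neg_cancel, zpow_zero, Units.val_one, one_smul]

attribute [local instance] LieRing.ofAssociativeRing in
lemma twistedToLoop_divPow (z : twistedLoop σ.toLieEquiv ζ) (k : ℕ) :
    twistedToLoop σ.toLieEquiv ζ (divPow (UniversalEnvelopingAlgebra.ι ℂ z) k) =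
      divPow (UniversalEnvelopingAlgebra.ι ℂ (z : Loop L)) k := by
  rw [map_divPow]
  congr 1
  exact UniversalEnvelopingAlgebra.lift_ι_apply ℂ _ z

include hσ hζ in
lemma twistedToLoop_mem_range (hm : σ.order ∈ ({1, 2, 3} : Set ℕ)) {O : Set H.root}
    (u : twistedForm σ ζ O) :
    twistedToLoop σ.toLieEquiv ζ u ∈ (coeffMul C ζ).range := by
  obtain ⟨u, hu⟩ := u
  have hle : twistedForm σ ζ O ≤ (coeffMul C ζ).range.comap
      ((twistedToLoop σ.toLieEquiv ζ).restrictScalars ℤ) := by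
    refine Algebra.adjoin_le ?_
    rintro _ ⟨β, r, k, z, -, hz, rfl⟩
    obtain ⟨W, hW⟩ := exists_isLift hσ hζ hm β r
    refine ⟨coeff k W, ?_⟩
    have h := congrArg (coeff k) hW
    rw [coeff_map, coeff_expSeries, ← hz, ← twistedToLoop_divPow] at h
    exact h
  exact hle hu

/-- The homomorphism `U_ℤ(g̃^σ) → ℤ[ζ, √2] ⊗ U_ℤ(g̃)` induced by the inclusion. -/
def formInclusion (hm : σ.order ∈ ({1, 2, 3} : Set ℕ)) (O : Set H.root) :
    twistedForm σ ζ O →ₐ[ℤ] (coeffRing ζ) ⊗[ℤ] (loopForm C) :=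
  (AlgEquiv.ofInjective (coeffMul C ζ) (coeffMul_injective b C ζ)).symm.toAlgHom.comp
    ((((twistedToLoop σ.toLieEquiv ζ).restrictScalars ℤ).comp (twistedForm σ ζ O).val).codRestrict
      (coeffMul C ζ).range (twistedToLoop_mem_range hσ hζ hm))

lemma coeffMul_formInclusion (hm : σ.order ∈ ({1, 2, 3} : Set ℕ)) (O : Set H.root)
    (u : twistedForm σ ζ O) :
    coeffMul C ζ (formInclusion hσ hζ hm O u) = twistedToLoop σ.toLieEquiv ζ u :=
  congrArg Subtype.val
    ((AlgEquiv.ofInjective (coeffMul C ζ) (coeffMul_injective b C ζ)).apply_symm_apply _)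

/-- The homomorphism `U_F(g̃^σ) → U_F(g̃)` induced by the inclusion. -/
def hyperInclusion (hm : σ.order ∈ ({1, 2, 3} : Set ℕ)) (O : Set H.root) (χ : coeffRing ζ →+* F) :
    TwistedHyper σ ζ O F →ₐ[F] HyperLoop C F :=
  Algebra.TensorProduct.lift (Algebra.ofId F (HyperLoop C F))
    ((coeffReduce C χ).comp (formInclusion hσ hζ hm O)) fun c _ => Algebra.commutes c _

lemma isInducedByInclusion_hyperInclusion (hm : σ.order ∈ ({1, 2, 3} : Set ℕ)) (O : Set H.root)
    (χ : coeffRing ζ →+* F) :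
    IsInducedByInclusion σ χ (hyperInclusion hσ hζ hm O χ) := fun u =>
  ⟨formInclusion hσ hζ hm O u, coeffMul_formInclusion hσ hζ hm O u,
    (Algebra.TensorProduct.lift_tmul _ _ _ _ _).trans (by rw [map_one, one_mul]; rfl)⟩

/-- Injectivity of `coeffMul` makes the lift of `u` unique, which prescribes the value on `1 ⊗ u`;
these elements span over `F`. -/
lemma isInducedByInclusion_unique {O : Set H.root} {χ : coeffRing ζ →+* F}
    {φ φ' : TwistedHyper σ ζ O F →ₐ[F] HyperLoop C F}
    (h : IsInducedByInclusion σ χ φ) (h' : IsInducedByInclusion σ χ φ') : φ' = φ := by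
  refine Algebra.TensorProduct.ext' fun c u => ?_
  obtain ⟨w, hw, e⟩ := h u
  obtain ⟨w', hw', e'⟩ := h' u
  rw [← mul_one c, ← smul_eq_mul, ← TensorProduct.smul_tmul', map_smul, map_smul, e, e',
    coeffMul_injective b C ζ (hw'.trans hw.symm)]

include hζ in
/-- The series of divided powers of `x_{β, -r} ⊗ t ^ r` is in the image of `U_F(g̃^σ)`. -/
lemma coeff_map_coeffReduce_mem_range {O : Set H.root} {χ : coeffRing ζ →+* F}
    {φ : TwistedHyper σ ζ O F →ₐ[F] HyperLoop C F} (hφ : IsInducedByInclusion σ χ φ)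
    {β : H.root} (hβ : ∃ α ∈ O, (rootSystem H).root β = (rootSystem H).root α ∨
      (rootSystem H).root β = -(rootSystem H).root α) {r : ℤ}
    {W : ((coeffRing ζ) ⊗[ℤ] (loopForm C))⟦X⟧} (hW : IsLift σ β r W) (k : ℕ) :
    coeff k (PowerSeries.map (coeffReduce C χ : _ →+* _) W) ∈ φ.range := by
  let z : twistedLoop σ.toLieEquiv ζ := ⟨_, monom_twistedVec_mem hζ β r⟩
  let u : twistedForm σ ζ O := ⟨divPow (UniversalEnvelopingAlgebra.ι ℂ z) k,
    Algebra.subset_adjoin ⟨β, r, k, z, hβ, rfl, rfl⟩⟩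
  obtain ⟨w, hw, e⟩ := hφ u
  have h := congrArg (coeff k) hW
  rw [coeff_map, coeff_expSeries, ← twistedToLoop_divPow z] at h
  have h2 : w = coeff k W := coeffMul_injective b C ζ (hw.trans h.symm)
  rw [coeff_map]
  exact ⟨_, e.trans (by rw [h2]; rfl)⟩

end Twisted

/-! ### Membership of generating series in a subalgebra, and separation of factors. -/

section SeriesMem

open PowerSeries

variable {F U : Type*} [Field F] [Ring U] [Algebra F U] (A : Subalgebra F U)

/-- The coefficients of the power series `W` lie in the subalgebra `A`. -/
def SeriesMem (W : U⟦X⟧) : Prop := ∀ k, coeff k W ∈ A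

variable {A}

lemma SeriesMem.mul {V W : U⟦X⟧} (hV : SeriesMem A V) (hW : SeriesMem A W) :
    SeriesMem A (V * W) := fun k => by
  rw [coeff_mul]
  exact sum_mem fun x _ => mul_mem (hV _) (hW _)

lemma SeriesMem.sqSubst {W : U⟦X⟧} (hW : SeriesMem A W) : SeriesMem A (sqSubst W) := fun k => by
  rw [coeff_sqSubst]
  split_ifs
  · exact hW _
  · exact zero_mem A

lemma coeff_mul_of_homogeneous {c : F} {V V' W W' : U⟦X⟧}
    (hV : ∀ k, coeff k V' = c ^ k • coeff k V) (hW : ∀ k, coeff k W' = c ^ k • coeff k W) (k : ℕ) :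
    coeff k (V' * W') = c ^ k • coeff k (V * W) := by
  rw [coeff_mul, coeff_mul, Finset.smul_sum]
  refine Finset.sum_congr rfl fun x hx => ?_
  rw [Finset.HasAntidiagonal.mem_antidiagonal] at hx
  rw [hV, hW, smul_mul_smul_comm, ← pow_add, hx]

end SeriesMem

section DivPowSubmodule

open LieAlgebra LieAlgebra.IsKilling PowerSeries

variable {L : Type*} [LieRing L] [LieAlgebra ℂ L] [IsKilling ℂ L] [FiniteDimensional ℂ L]
  {H : LieSubalgebra ℂ L} [H.IsCartanSubalgebra] {C : ChevalleyBasis H}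
  {F : Type*} [Field F] (A : Subalgebra F (HyperLoop C F))

/-- The Laurent polynomials `p` such that all `(x α ⊗ p) ^ (k)` lie in `A`. -/
def divPowSubmodule (α : H.root) : Submodule F F[T;T⁻¹] where
  carrier := {p | SeriesMem A (hyperSeries C α p)}
  add_mem' {p q} hp hq := by
    change SeriesMem A (hyperSeries C α (p + q))
    rw [hyperSeries_add]
    exact hp.mul hq
  zero_mem' := fun k => by
    rw [hyperSeries_zero, coeff_one]
    split_ifs
    · exact one_mem A
    · exact zero_mem A
  smul_mem' c p hp := fun k => by
    rw [coeff_hyperSeries_smul]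
    exact A.smul_mem (hp k) _

variable {A}

lemma mem_divPowSubmodule {α : H.root} {p : F[T;T⁻¹]} :
    p ∈ divPowSubmodule A α ↔ SeriesMem A (hyperSeries C α p) := Iff.rfl

lemma coeff_zero_hyperSeries (α : H.root) (p : F[T;T⁻¹]) : coeff 0 (hyperSeries C α p) = 1 := by
  induction p using laurent_induction with
  | hT c r =>
    rw [hyperSeries_C_mul_T, coeff_mk, pow_zero, one_smul, (isDividedFamily_hyperGen C α).zero]
  | hadd p q hp hq =>
    rw [hyperSeries_add, coeff_mul, Finset.HasAntidiagonal.antidiagonal_zero, Finset.sum_singleton, hp, hq, one_mul]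

lemma mem_divPowSubmodule_of_dvd {α : H.root} {h : F[T;T⁻¹]}
    (hA : ∀ (k : ℤ) (r : ℕ), 0 < r → hyperDivPow C α (LaurentPolynomial.T k * h) r ∈ A)
    (q : F[T;T⁻¹]) (hq : h ∣ q) : q ∈ divPowSubmodule A α := by
  obtain ⟨p, rfl⟩ := hq
  induction p using laurent_induction with
  | hT c r =>
    rw [mul_comm, mul_assoc, ← LaurentPolynomial.smul_eq_C_mul]
    refine Submodule.smul_mem _ _ fun k => ?_
    rcases Nat.eq_zero_or_pos k with rfl | hk
    · rw [coeff_zero_hyperSeries]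
      exact one_mem A
    · rw [hyperSeries, coeff_mk]
      exact hA r k hk
  | hadd p q hp hq =>
    rw [mul_add]
    exact add_mem hp hq

/-- The inverse of the removed factor is the series of `-p`, whose coefficients are again in `A`. -/
lemma seriesMem_of_mul_left {α : H.root} {p : F[T;T⁻¹]} {W : (HyperLoop C F)⟦X⟧}
    (hp : SeriesMem A (W * hyperSeries C α p)) (hα : p ∈ divPowSubmodule A α) :
    SeriesMem A W := by
  have h := hp.mul (mem_divPowSubmodule.mp (neg_mem hα))
  rwa [mul_assoc, hyperSeries_mul_neg, mul_one] at h

lemma seriesMem_of_mul_right {α : H.root} {p : F[T;T⁻¹]} {W : (HyperLoop C F)⟦X⟧}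
    (hp : SeriesMem A (hyperSeries C α p * W)) (hα : p ∈ divPowSubmodule A α) :
    SeriesMem A W := by
  have h := (mem_divPowSubmodule.mp (neg_mem hα)).mul hp
  rwa [← mul_assoc, hyperSeries_neg_mul, one_mul] at h

lemma divPowSubmodule_eq_top_of_smul_scaleLaurent {α : H.root} {c : F} (hc : c ≠ 0) (ω : Fˣ)
    (h : ∀ p, c • scaleLaurent ω p ∈ divPowSubmodule A α) : divPowSubmodule A α = ⊤ := by
  refine eq_top_iff.mpr fun p _ => ?_
  have h1 := h (c⁻¹ • scaleLaurent ω⁻¹ p)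
  rwa [map_smul, scaleLaurent_scaleLaurent, mul_inv_cancel, scaleLaurent_one, smul_smul,
    mul_inv_cancel₀ hc, one_smul] at h1

lemma coeff_hyperSeries_mul_smul (α β : H.root) (c : F) (p q : F[T;T⁻¹]) (k : ℕ) :
    coeff k (hyperSeries C α (c • p) * hyperSeries C β (c • q)) =
      c ^ k • coeff k (hyperSeries C α p * hyperSeries C β q) :=
  coeff_mul_of_homogeneous (coeff_hyperSeries_smul C α c p) (coeff_hyperSeries_smul C β c q) k

variable {h : F[T;T⁻¹]} {ω : Fˣ}

/-- Separation of the factors of the divided powers of a sum of two root vectors. -/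
lemma divPowSubmodule_eq_top_of_pair {α β : H.root} {c : F} (hc : c ≠ 0)
    (hA : ∀ α q, h ∣ q → q ∈ divPowSubmodule A α)
    (hint : ∀ q, ∃ p, h ∣ p - q ∧ h ∣ scaleLaurent ω p)
    (hΦ : ∀ p, SeriesMem A (hyperSeries C α p * hyperSeries C β (c • scaleLaurent ω p))) :
    divPowSubmodule A α = ⊤ ∧ divPowSubmodule A β = ⊤ := by
  have hα : divPowSubmodule A α = ⊤ := by
    refine eq_top_iff.mpr fun q _ => ?_
    obtain ⟨p, hp, hp1⟩ := hint q
    rw [← sub_sub_self p q]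
    refine sub_mem ?_ (hA _ _ hp)
    exact seriesMem_of_mul_left (hΦ p) (Submodule.smul_mem _ _ (hA _ _ hp1))
  refine ⟨hα, divPowSubmodule_eq_top_of_smul_scaleLaurent hc ω fun p => ?_⟩
  exact seriesMem_of_mul_right (hΦ p) (hα ▸ Submodule.mem_top)

/-- Separation of the factors of the divided powers of a sum of three root vectors. -/
lemma divPowSubmodule_eq_top_of_triple {α β γ : H.root} {c d : F} (hc : c ≠ 0) (hd : d ≠ 0)
    (hA : ∀ α q, h ∣ q → q ∈ divPowSubmodule A α)
    (hint : ∀ q, ∃ p, h ∣ p - q ∧ h ∣ scaleLaurent ω p ∧ h ∣ scaleLaurent (ω ^ 2) p)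
    (hΦ : ∀ p, SeriesMem A (hyperSeries C α p * hyperSeries C β (c • scaleLaurent ω p) *
      hyperSeries C γ (d • scaleLaurent (ω ^ 2) p))) :
    divPowSubmodule A α = ⊤ ∧ divPowSubmodule A β = ⊤ ∧ divPowSubmodule A γ = ⊤ := by
  have hα : divPowSubmodule A α = ⊤ := by
    refine eq_top_iff.mpr fun q _ => ?_
    obtain ⟨p, hp, hp1, hp2⟩ := hint q
    rw [← sub_sub_self p q]
    refine sub_mem ?_ (hA _ _ hp)
    exact seriesMem_of_mul_left (seriesMem_of_mul_left (hΦ p)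
      (Submodule.smul_mem _ _ (hA _ _ hp2))) (Submodule.smul_mem _ _ (hA _ _ hp1))
  refine ⟨hα, divPowSubmodule_eq_top_of_pair (c := d * c⁻¹) (mul_ne_zero hd (inv_ne_zero hc)) hA
    (fun q => (hint q).imp fun p hp => ⟨hp.1, hp.2.1⟩) fun p => ?_⟩
  -- With the `α`-factor removed, this substitution makes the `β`-argument `p` and the `γ`-argument
  -- `d c⁻¹ p(ωt)`, the shape of a pair.
  have h1 := hΦ (c⁻¹ • scaleLaurent ω⁻¹ p)
  rw [mul_assoc] at h1
  have h2 := seriesMem_of_mul_right h1 (hα ▸ Submodule.mem_top)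
  rwa [map_smul, map_smul, scaleLaurent_scaleLaurent, scaleLaurent_scaleLaurent, mul_inv_cancel,
    scaleLaurent_one, smul_smul, smul_smul, mul_inv_cancel₀ hc, one_smul, sq,
    mul_inv_cancel_right] at h2

/-- Passage from monomials to Laurent polynomials for the divided powers of a sum of two root
vectors that commute up to elements of the subalgebra. -/
lemma seriesMem_pair {α β : H.root} {c d : F} (hd : d ≠ 0)
    (hex : ∀ p q, ∃ E, SeriesMem A E ∧ (∀ p, Commute (hyperSeries C α p) E) ∧
      hyperSeries C α p * hyperSeries C β q = E * (hyperSeries C β q * hyperSeries C α p))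
    (hT : ∀ r : ℤ, SeriesMem A (hyperSeries C α (d • LaurentPolynomial.T r) *
      hyperSeries C β (c • scaleLaurent ω (d • LaurentPolynomial.T r)))) (p : F[T;T⁻¹]) :
    SeriesMem A (hyperSeries C α p * hyperSeries C β (c • scaleLaurent ω p)) := by
  induction p using laurent_induction with
  | hT e r =>
    intro k
    -- Only the monomials scaled by `d` are given, with `d = χ(√2)` in the Heisenberg case;
    -- homogeneity of the coefficients then yields every scalar `e`.
    have he : LaurentPolynomial.C e * LaurentPolynomial.T r =
        (e * d⁻¹) • d • (LaurentPolynomial.T r : F[T;T⁻¹]) := by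
      rw [smul_smul, inv_mul_cancel_right₀ hd, LaurentPolynomial.smul_eq_C_mul]
    rw [he, map_smul, smul_comm c, coeff_hyperSeries_mul_smul]
    exact A.smul_mem (hT r k) _
  | hadd p q hp hq =>
    -- Passing the `β`-series of `p` across the `α`-series of `q` produces `E`, which moves to the
    -- front past the `α`-series of `p`.
    obtain ⟨E, hE, hcomm, hpq⟩ := hex q (c • scaleLaurent ω p)
    rw [map_add, smul_add, hyperSeries_add, hyperSeries_add]
    have e : ∀ {a a' b b' E : (HyperLoop C F)⟦X⟧}, Commute a E → a' * b = E * (b * a') →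
        a * a' * (b * b') = E * (a * b * (a' * b')) := by
      intro a a' b b' E h1 h2
      calc a * a' * (b * b') = a * (a' * b) * b' := by simp only [mul_assoc]
        _ = (a * E) * b * a' * b' := by rw [h2]; simp only [mul_assoc]
        _ = E * (a * b * (a' * b')) := by rw [h1.eq]; simp only [mul_assoc]
    rw [e (hcomm p) hpq]
    exact hE.mul (hp.mul hq)

lemma seriesMem_triple {α β γ : H.root} {c d : F}
    (hαβ : ⁅C.x α, C.x β⁆ = 0) (hβγ : ⁅C.x β, C.x γ⁆ = 0) (hαγ : ⁅C.x α, C.x γ⁆ = 0)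
    (hT : ∀ r : ℤ, SeriesMem A (hyperSeries C α (LaurentPolynomial.T r) *
      hyperSeries C β (c • scaleLaurent ω (LaurentPolynomial.T r)) *
      hyperSeries C γ (d • scaleLaurent (ω ^ 2) (LaurentPolynomial.T r)))) (p : F[T;T⁻¹]) :
    SeriesMem A (hyperSeries C α p * hyperSeries C β (c • scaleLaurent ω p) *
      hyperSeries C γ (d • scaleLaurent (ω ^ 2) p)) := by
  induction p using laurent_induction with
  | hT e r =>
    intro k
    rw [← LaurentPolynomial.smul_eq_C_mul, map_smul, map_smul, smul_comm c, smul_comm d]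
    rw [coeff_mul_of_homogeneous (coeff_hyperSeries_mul_smul α β e _ _)
      (coeff_hyperSeries_smul C γ e _)]
    exact A.smul_mem (hT r k) _
  | hadd p q hp hq =>
    rw [map_add, map_add, smul_add, smul_add, hyperSeries_add, hyperSeries_add, hyperSeries_add]
    have h1 := hp.mul hq
    have c1 := (commute_hyperSeries C hαβ q (c • scaleLaurent ω p))
    have c2 := (commute_hyperSeries C hαγ q (d • scaleLaurent (ω ^ 2) p))
    have c3 := (commute_hyperSeries C hβγ (c • scaleLaurent ω q) (d • scaleLaurent (ω ^ 2) p))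
    have e : ∀ {a a' b b' g g' : (HyperLoop C F)⟦X⟧}, Commute a' b → Commute a' g → Commute b' g →
        a * b * g * (a' * b' * g') = a * a' * (b * b') * (g * g') := by
      intro a a' b b' g g' h1 h2 h3
      calc a * b * g * (a' * b' * g') = a * b * (g * (a' * b')) * g' := by simp only [mul_assoc]
        _ = a * b * (a' * b' * g) * g' := by rw [(h2.mul_left h3).eq]
        _ = a * (b * a') * b' * g * g' := by simp only [mul_assoc]
        _ = a * (a' * b) * b' * g * g' := by rw [h1.eq]
        _ = a * a' * (b * b') * (g * g') := by simp only [mul_assoc]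
    rwa [e c1 c2 c3] at h1

lemma eq_top_of_hyperGen_mem (hA : ∀ α r k, hyperGen C F α r k ∈ A) : A = ⊤ := by
  have hform : loopForm C ≤ ((A.restrictScalars ℤ).comap
      (Algebra.TensorProduct.includeRight : loopForm C →ₐ[ℤ] HyperLoop C F)).map
        (loopForm C).val := by
    refine Algebra.adjoin_le ?_
    rintro _ ⟨α, r, k, rfl⟩
    exact ⟨formGen C α r k, hA α r k, rfl⟩
  refine eq_top_iff.mpr fun u _ => ?_
  induction u using TensorProduct.induction_on with
  | zero => exact zero_mem A
  | add u v hu hv => exact add_mem (hu trivial) (hv trivial)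
  | tmul c v =>
    obtain ⟨v', hv', e⟩ := hform v.2
    obtain rfl : v' = v := Subtype.ext e
    rw [← mul_one c, ← smul_eq_mul, ← TensorProduct.smul_tmul']
    exact A.smul_mem hv' c

lemma eq_top_of_divPowSubmodule_eq_top (hA : ∀ α, divPowSubmodule A α = ⊤) : A = ⊤ := by
  refine eq_top_of_hyperGen_mem fun α r k => ?_
  have h : LaurentPolynomial.C 1 * LaurentPolynomial.T r ∈ divPowSubmodule A α :=
    hA α ▸ Submodule.mem_top
  have h1 := mem_divPowSubmodule.mp h k
  rwa [hyperSeries_C_mul_T, coeff_mk, one_pow, one_smul] at h1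

end DivPowSubmodule

/-! ### Orbit representatives. -/

section Roots

open LieAlgebra LieAlgebra.IsKilling

variable {L : Type*} [LieRing L] [LieAlgebra ℂ L] [IsKilling ℂ L] [FiniteDimensional ℂ L]
  {H : LieSubalgebra ℂ L} [H.IsCartanSubalgebra]
  {b : (rootSystem H).Base} {C : ChevalleyBasis H} {σ : DiagramAut b C}

/-- `β` is one of the given representatives or the negative of one. -/
def IsRep (O : Set H.root) (β : H.root) : Prop :=
  ∃ α ∈ O, (rootSystem H).root β = (rootSystem H).root α ∨
    (rootSystem H).root β = -(rootSystem H).root α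

lemma root_iterate_perm_neg {α β : H.root}
    (h : (rootSystem H).root β = -(rootSystem H).root α) (j : ℕ) :
    (rootSystem H).root (σ.perm^[j] β) = -(rootSystem H).root (σ.perm^[j] α) := by
  induction j with
  | zero => exact h
  | succ j ih =>
    rw [Function.iterate_succ_apply', Function.iterate_succ_apply']
    exact σ.root_perm_neg ih

lemma exists_isRep {O : Set H.root} (hO : IsOrbitReps σ O) (δ : H.root) :
    ∃ β, IsRep O β ∧ ∃ j : ℕ, σ.perm^[j] β = δ := by
  by_cases h : b.IsPos δ
  · obtain ⟨α, ⟨hα, hj⟩, -⟩ := hO.2 δ h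
    exact ⟨α, ⟨α, hα, Or.inl rfl⟩, hj⟩
  · obtain ⟨δ', hδ⟩ := exists_neg_root δ
    have h' : b.IsPos δ' := by
      rw [RootPairing.Base.isPos_iff'] at h ⊢
      rw [height_neg hδ]
      linarith
    obtain ⟨α, ⟨hα, j, hj⟩, -⟩ := hO.2 δ' h'
    obtain ⟨β, hβ⟩ := exists_neg_root α
    refine ⟨β, ⟨α, hα, Or.inr hβ⟩, j, (rootSystem H).root.injective ?_⟩
    rw [root_iterate_perm_neg hβ, hj, hδ, neg_neg]

/-- The orbit of a fixed root has one element, which must then be the chosen one, up to sign. -/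
lemma isRep_of_perm_eq {O : Set H.root} (hO : IsOrbitReps σ O) {δ : H.root}
    (hδ : σ.perm δ = δ) : IsRep O δ := by
  obtain ⟨β, hβ, j, hj⟩ := exists_isRep hO δ
  have h : σ.perm^[j] β = σ.perm^[j] δ := hj.trans (Function.iterate_fixed hδ j).symm
  rwa [← σ.perm.injective.iterate j h]

lemma sign_pow_order {β : H.root} (hβ : σ.perm β = β) : (((σ.sign β : ℤ) : ℂ)) ^ σ.order = 1 := by
  have h : ∀ j : ℕ, (σ.toLieEquiv)^[j] (C.x β) = (((σ.sign β : ℤ) : ℂ) ^ j) • C.x β := by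
    intro j
    induction j with
    | zero => simp
    | succ j ih =>
      rw [Function.iterate_succ_apply', ih]
      refine (σ.toLieEquiv.toLinearEquiv.map_smul _ _).trans ?_
      change _ • σ.toLieEquiv (C.x β) = _
      rw [σ.toLieEquiv_x, hβ, ← Int.cast_smul_eq_zsmul ℂ, smul_smul, pow_succ]
  have h1 := h σ.order
  rw [σ.iterate_order, id] at h1
  have h2 : ((((σ.sign β : ℤ) : ℂ)) ^ σ.order - 1) • C.x β = 0 := by
    rw [sub_smul, one_smul, ← h1, sub_self]
  exact sub_eq_zero.mp ((smul_eq_zero.mp h2).resolve_right (chevalley_ne_zero C β))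

end Roots

/-! ### Surjectivity modulo the ideal. -/

section Surjective

open LieAlgebra LieAlgebra.IsKilling PowerSeries

/-- The image of `ζ` under a ring homomorphism from `ℤ[ζ, √2]`. -/
def zetaImage {F : Type*} [Field F] {ζ : ℂˣ} (χ : coeffRing ζ →+* F) {m : ℕ} (hm : m ≠ 0)
    (hζ : ζ ^ m = 1) : Fˣ := Units.map (χ : coeffRing ζ →* F) (zetaUnit hm hζ)

lemma coe_zetaImage_zpow {F : Type*} [Field F] {ζ : ℂˣ} (χ : coeffRing ζ →+* F) {m : ℕ}
    (hm : m ≠ 0) (hζ : ζ ^ m = 1) (r : ℤ) :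
    χ ((zetaUnit hm hζ ^ r : (coeffRing ζ)ˣ) : coeffRing ζ) =
      ((zetaImage χ hm hζ ^ r : Fˣ) : F) :=
  congrArg Units.val (map_zpow (Units.map (χ : coeffRing ζ →* F)) (zetaUnit hm hζ) r)

/-- For `m` prime it suffices that the image is not `1`. Otherwise `1 + ζ + ⋯ + ζ^(m-1) = 0` would
become `m = 0` in `F`, and the characteristic would be `m`. -/
lemma isPrimitiveRoot_zetaImage {F : Type*} [Field F] {ζ : ℂˣ} (χ : coeffRing ζ →+* F) {m : ℕ}
    (hm : m ≠ 0) (hζ : IsPrimitiveRoot ζ m) (hprime : m = 1 ∨ m.Prime) (hchar : ringChar F ≠ m) :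
    IsPrimitiveRoot (zetaImage χ hm hζ.pow_eq_one) m := by
  rcases hprime with rfl | hp
  · rw [IsPrimitiveRoot.one_right_iff]
    have h1 : zetaUnit hm hζ.pow_eq_one ^ 1 = 1 := Units.pow_ofPowEqOne _ hm
    rw [zetaImage, ← pow_one (zetaUnit _ _), h1, map_one]
  · have : Fact m.Prime := ⟨hp⟩
    have h1 : zetaUnit hm hζ.pow_eq_one ^ m = 1 := Units.pow_ofPowEqOne _ hm
    have h2 : zetaImage χ hm hζ.pow_eq_one ^ m = 1 := by rw [zetaImage, ← map_pow, h1, map_one]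
    have h3 : zetaImage χ hm hζ.pow_eq_one ≠ 1 := by
      intro h
      have h4 : ∑ i ∈ Finset.range m, ((zetaUnit hm hζ.pow_eq_one : coeffRing ζ)) ^ i = 0 := by
        apply Subtype.ext
        rw [AddSubmonoidClass.coe_finsetSum]
        exact (IsPrimitiveRoot.coe_units_iff.mpr hζ).geom_sum_eq_zero hp.one_lt
      have h5 := congrArg χ h4
      have h6 : χ (zetaUnit hm hζ.pow_eq_one : coeffRing ζ) = 1 := congrArg Units.val h
      rw [map_sum, map_zero] at h5
      simp only [map_pow, h6, one_pow, Finset.sum_const, Finset.card_range, nsmul_eq_mul,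
        mul_one] at h5
      rcases (Nat.dvd_prime hp).mp (ringChar.dvd h5) with h7 | h7
      · exact CharP.char_ne_one F (ringChar F) h7
      · exact hchar h7
    have h4 := IsPrimitiveRoot.orderOf (zetaImage χ hm hζ.pow_eq_one)
    rwa [orderOf_eq_prime h2 h3] at h4

variable {L : Type*} [LieRing L] [LieAlgebra ℂ L] [IsKilling ℂ L] [FiniteDimensional ℂ L]
  {H : LieSubalgebra ℂ L} [H.IsCartanSubalgebra]
  {b : (rootSystem H).Base} {C : ChevalleyBasis H} {σ : DiagramAut b C}
  {F : Type*} [Field F] {ζ : ℂˣ} {O : Set H.root} {χ : coeffRing ζ →+* F}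
  {φ : TwistedHyper σ ζ O F →ₐ[F] HyperLoop C F} {A : Subalgebra F (HyperLoop C F)}
  {h : F[T;T⁻¹]}

lemma seriesMem_of_isLift (hζ : ζ ^ σ.order = 1) (hφ : IsInducedByInclusion σ χ φ)
    (hφA : φ.range ≤ A) {β : H.root} (hβ : IsRep O β) {r : ℤ}
    {W : ((coeffRing ζ) ⊗[ℤ] (loopForm C))⟦X⟧} (hW : IsLift σ β r W) :
    SeriesMem A (PowerSeries.map (coeffReduce C χ : _ →+* _) W) := fun k =>
  hφA (coeff_map_coeffReduce_mem_range hζ hφ hβ hW k)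

lemma C_mul_T_eq_smul_scaleLaurent (hσ : σ.order ≠ 0) (hζ : ζ ^ σ.order = 1) (s : ℤ) (r : ℤ) :
    LaurentPolynomial.C (χ ((s : coeffRing ζ) *
      ((zetaUnit hσ hζ ^ r : (coeffRing ζ)ˣ) : coeffRing ζ))) * LaurentPolynomial.T r =
      (s : F) • scaleLaurent (zetaImage χ hσ hζ) (LaurentPolynomial.T r) := by
  rw [scaleLaurent_T, map_mul, map_intCast, coe_zetaImage_zpow, smul_smul,
    LaurentPolynomial.smul_eq_C_mul]

lemma C_mul_T_eq_smul_scaleLaurent_sq (hσ : σ.order ≠ 0) (hζ : ζ ^ σ.order = 1) (s : ℤ) (r : ℤ) :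
    LaurentPolynomial.C (χ ((s : coeffRing ζ) *
      ((zetaUnit hσ hζ ^ (2 * r) : (coeffRing ζ)ˣ) : coeffRing ζ))) * LaurentPolynomial.T r =
      (s : F) • scaleLaurent (zetaImage χ hσ hζ ^ 2) (LaurentPolynomial.T r) := by
  rw [scaleLaurent_T, map_mul, map_intCast, coe_zetaImage_zpow, smul_smul,
    LaurentPolynomial.smul_eq_C_mul, ← zpow_natCast, ← zpow_mul, Nat.cast_ofNat]

lemma intCast_units_ne_zero (s : ℤˣ) : ((s : ℤ) : F) ≠ 0 := by
  rcases Int.units_eq_one_or s with rfl | rfl <;> simp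

/-- The sign of `σ` on `x_β` is an `m`-th root of unity `ζ^i`. For `r ≡ -i` mod `m` the element `x_β
⊗ t^r` is itself a twisted generator, and `eq_top_of_T_mem` supplies the other exponents. -/
lemma divPowSubmodule_eq_top_of_perm_eq (hσ : σ.order ≠ 0) (hζ : IsPrimitiveRoot ζ σ.order)
    (hω : IsPrimitiveRoot (zetaImage χ hσ hζ.pow_eq_one) σ.order)
    (hφ : IsInducedByInclusion σ χ φ) (hφA : φ.range ≤ A)
    (hh : ∀ j, 0 < j → j < σ.order →
      IsCoprime h (scaleLaurent (zetaImage χ hσ hζ.pow_eq_one ^ j) h))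
    (hA : ∀ α q, h ∣ q → q ∈ divPowSubmodule A α) {β : H.root} (hβO : IsRep O β)
    (hβ : σ.perm β = β) : divPowSubmodule A β = ⊤ := by
  have : NeZero σ.order := ⟨hσ⟩
  obtain ⟨i, -, hi⟩ := (IsPrimitiveRoot.coe_units_iff.mpr hζ).eq_pow_of_pow_eq_one
    (sign_pow_order hβ)
  refine eq_top_of_T_mem (Nat.pos_of_ne_zero hσ) hω hh (hA β) (-(i : ℤ)) fun r hr => ?_
  have h1 : ζ ^ (-r) = ζ ^ i := by
    obtain ⟨c, hc⟩ := hr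
    rw [show -r = (i : ℤ) - σ.order * c by linarith, zpow_sub, zpow_mul, zpow_natCast,
      zpow_natCast, hζ.pow_eq_one, one_zpow, inv_one, mul_one]
  have h2 : σ.toLieEquiv (C.x β) = ((ζ ^ (-r) : ℂˣ) : ℂ) • C.x β := by
    rw [h1, Units.val_pow_eq_pow_val, hi, Int.cast_smul_eq_zsmul, σ.toLieEquiv_x, hβ]
  have h3 := seriesMem_of_isLift hζ.pow_eq_one hφ hφA hβO (isLift_of_perm_eq hβ h2)
  rwa [map_coeffReduce_formSeries, map_one, map_one, one_mul] at h3

lemma divPowSubmodule_eq_top_of_order_eq_two (hσ : σ.order ≠ 0) (hζ : IsPrimitiveRoot ζ σ.order)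
    (hω : IsPrimitiveRoot (zetaImage χ hσ hζ.pow_eq_one) σ.order) (hO : IsOrbitReps σ O)
    (hφ : IsInducedByInclusion σ χ φ) (hφA : φ.range ≤ A)
    (hh : ∀ j, 0 < j → j < σ.order →
      IsCoprime h (scaleLaurent (zetaImage χ hσ hζ.pow_eq_one ^ j) h))
    (hA : ∀ α q, h ∣ q → q ∈ divPowSubmodule A α) (h2 : σ.order = 2) (hchar : (2 : F) ≠ 0)
    {β : H.root} (hβO : IsRep O β) (hβ : σ.perm β ≠ β) :
    divPowSubmodule A β = ⊤ ∧ divPowSubmodule A (σ.perm β) = ⊤ := by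
  refine divPowSubmodule_eq_top_of_pair (h := h) (ω := zetaImage χ hσ hζ.pow_eq_one)
    (intCast_units_ne_zero (σ.sign β)) hA (fun q => ?_) ?_
  · obtain ⟨p, hp, hp1⟩ := exists_interpolation hω.pow_eq_one hh q
    exact ⟨p, hp, by simpa using hp1 1 one_pos (by omega)⟩
  by_cases hγ : (rootSystem H).root β + (rootSystem H).root (σ.perm β) ∈
    Set.range (rootSystem H).root
  · obtain ⟨γ, hγ⟩ := hγ
    obtain ⟨κ, hκ⟩ := exists_lie_perm_eq hγ
    have hγσ := σ.perm_eq_self_of_add h2 hγ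
    -- The root `γ = β + σβ` is fixed by `σ`, so the preceding case disposes of all its series.
    have htop : ∀ p, SeriesMem A (sqSubst (hyperSeries C γ p)) := fun p => by
      have h3 := divPowSubmodule_eq_top_of_perm_eq hσ hζ hω hφ hφA hh hA
        (isRep_of_perm_eq hO hγσ) hγσ
      exact SeriesMem.sqSubst (mem_divPowSubmodule.mp (h3 ▸ Submodule.mem_top))
    have hl1 := σ.lie_add_perm_eq_zero h2 hβ hγ
    have hl2 := σ.lie_perm_add_perm_eq_zero h2 hβ hγ
    have hd : χ (sqrtTwo ζ) ≠ 0 := by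
      intro h0
      have h3 := congrArg χ (sqrtTwo_mul_self ζ)
      rw [map_mul, h0, mul_zero, map_ofNat] at h3
      exact hchar h3.symm
    refine seriesMem_pair hd (fun p q => ⟨_, htop _, fun p' => ?_,
      hyperSeries_exchange C hκ hl1 hl2 p q⟩) fun r => ?_
    · exact commute_sqSubst fun i j => commute_coeff_hyperSeries C hl1 _ _ i j
    · have h3 := seriesMem_of_isLift hζ.pow_eq_one hφ hφA hβO
        (isLift_of_root_add hσ hζ.pow_eq_one h2 r hβ hγ hκ)
      rw [map_mul, map_mul, map_sqSubst, map_coeffReduce_formSeries, map_coeffReduce_formSeries,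
        map_coeffReduce_formSeries] at h3
      -- Multiplication by the inverse of the correction factor leaves the bare product of the two
      -- series.
      have h4 := h3.mul (htop (-(LaurentPolynomial.C (χ (-((κ : coeffRing ζ) *
        (((σ.sign β : ℤ) : coeffRing ζ) * ((zetaUnit hσ hζ.pow_eq_one ^ r : (coeffRing ζ)ˣ) :
          coeffRing ζ))))) * LaurentPolynomial.T (r + r))))
      rw [mul_assoc, ← sqSubst_mul, hyperSeries_mul_neg, sqSubst_one, mul_one, map_mul χ, map_mul,
        mul_assoc, C_mul_T_eq_smul_scaleLaurent, ← LaurentPolynomial.smul_eq_C_mul,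
        ← LaurentPolynomial.smul_eq_C_mul, smul_comm, ← map_smul] at h4
      exact h4
  · refine seriesMem_pair one_ne_zero (fun p q => ⟨1, ?_, fun p' => Commute.one_right _, ?_⟩)
      fun r => ?_
    · have h3 := mem_divPowSubmodule.mp (zero_mem (divPowSubmodule A β))
      rwa [hyperSeries_zero] at h3
    · rw [one_mul, (commute_hyperSeries C (σ.lie_perm_eq_zero hγ) p q).eq]
    · have h3 := seriesMem_of_isLift hζ.pow_eq_one hφ hφA hβO
        (isLift_of_order_eq_two hσ hζ.pow_eq_one h2 r hβ hγ)
      rw [map_mul, map_coeffReduce_formSeries, map_coeffReduce_formSeries,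
        C_mul_T_eq_smul_scaleLaurent, map_one, map_one, one_mul] at h3
      rwa [one_smul]

lemma divPowSubmodule_eq_top_of_order_eq_three (hσ : σ.order ≠ 0) (hζ : IsPrimitiveRoot ζ σ.order)
    (hω : IsPrimitiveRoot (zetaImage χ hσ hζ.pow_eq_one) σ.order)
    (hφ : IsInducedByInclusion σ χ φ) (hφA : φ.range ≤ A)
    (hh : ∀ j, 0 < j → j < σ.order →
      IsCoprime h (scaleLaurent (zetaImage χ hσ hζ.pow_eq_one ^ j) h))
    (hA : ∀ α q, h ∣ q → q ∈ divPowSubmodule A α) (h3 : σ.order = 3)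
    {β : H.root} (hβO : IsRep O β) (hβ : σ.perm β ≠ β) :
    divPowSubmodule A β = ⊤ ∧ divPowSubmodule A (σ.perm β) = ⊤ ∧
      divPowSubmodule A (σ.perm (σ.perm β)) = ⊤ := by
  refine divPowSubmodule_eq_top_of_triple (h := h) (ω := zetaImage χ hσ hζ.pow_eq_one)
    (intCast_units_ne_zero (σ.sign β)) (intCast_units_ne_zero (σ.sign β * σ.sign (σ.perm β))) hA
    (fun q => ?_) ?_
  · obtain ⟨p, hp, hp1⟩ := exists_interpolation hω.pow_eq_one hh q
    exact ⟨p, hp, by simpa using hp1 1 one_pos (by omega), hp1 2 two_pos (by omega)⟩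
  obtain ⟨c1, c2, c3⟩ := lie_perm_eq_zero_of_order_eq_three h3 hβ
  refine seriesMem_triple c1 c2 c3 fun r => ?_
  have h4 := seriesMem_of_isLift hζ.pow_eq_one hφ hφA hβO
    (isLift_of_order_eq_three hσ hζ.pow_eq_one h3 r hβ)
  rw [map_mul, map_mul, map_coeffReduce_formSeries, map_coeffReduce_formSeries,
    map_coeffReduce_formSeries, C_mul_T_eq_smul_scaleLaurent,
    C_mul_T_eq_smul_scaleLaurent_sq, map_one, map_one, one_mul] at h4
  exact h4

lemma divPowSubmodule_eq_top (hm : σ.order ∈ ({1, 2, 3} : Set ℕ)) (hσ : σ.order ≠ 0)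
    (hζ : IsPrimitiveRoot ζ σ.order)
    (hω : IsPrimitiveRoot (zetaImage χ hσ hζ.pow_eq_one) σ.order) (hO : IsOrbitReps σ O)
    (hchar : ringChar F ≠ σ.order)
    (hφ : IsInducedByInclusion σ χ φ) (hφA : φ.range ≤ A)
    (hh : ∀ j, 0 < j → j < σ.order →
      IsCoprime h (scaleLaurent (zetaImage χ hσ hζ.pow_eq_one ^ j) h))
    (hA : ∀ α q, h ∣ q → q ∈ divPowSubmodule A α) (δ : H.root) : divPowSubmodule A δ = ⊤ := by
  obtain ⟨β, hβO, j, rfl⟩ := exists_isRep hO δ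
  have hj : σ.perm^[j] β = σ.perm^[j % σ.order] β := by
    conv_lhs => rw [← Nat.mod_add_div j σ.order, Function.iterate_add_apply, Function.iterate_mul,
      Function.iterate_fixed (σ.perm_iterate_order β)]
  have hlt := Nat.mod_lt j (Nat.pos_of_ne_zero hσ)
  rw [hj]
  by_cases hβ : σ.perm β = β
  · rw [Function.iterate_fixed hβ]
    exact divPowSubmodule_eq_top_of_perm_eq hσ hζ hω hφ hφA hh hA hβO hβ
  rcases hm with h1 | h2 | h3
  · exact absurd (by simpa [h1] using σ.perm_iterate_order β) hβ
  · have hc : (2 : F) ≠ 0 := fun h0 => by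
      rcases (Nat.dvd_prime Nat.prime_two).mp (ringChar.dvd (R := F) (x := 2) (by simpa using h0))
        with h7 | h7
      · exact CharP.char_ne_one F (ringChar F) h7
      · exact hchar (h7.trans h2.symm)
    obtain ⟨t1, t2⟩ := divPowSubmodule_eq_top_of_order_eq_two hσ hζ hω hO hφ hφA hh hA h2 hc hβO hβ
    generalize j % σ.order = i at hlt
    rw [h2] at hlt
    interval_cases i
    exacts [t1, t2]
  · obtain ⟨t1, t2, t3⟩ :=
      divPowSubmodule_eq_top_of_order_eq_three hσ hζ hω hφ hφA hh hA h3 hβO hβ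
    generalize j % σ.order = i at hlt
    rw [show σ.order = 3 from h3] at hlt
    interval_cases i
    exacts [t1, t2, t3]

/-- The elements of `U_F(g̃)` that are congruent modulo the ideal `I` to an element of the image
of `φ`. -/
def rangeAddIdeal (φ : TwistedHyper σ ζ O F →ₐ[F] HyperLoop C F)
    (I : TwoSidedIdeal (HyperLoop C F)) : Subalgebra F (HyperLoop C F) where
  carrier := {x | ∃ u, x - φ u ∈ I}
  mul_mem' := by
    rintro x y ⟨u, hu⟩ ⟨v, hv⟩
    refine ⟨u * v, ?_⟩
    rw [map_mul, show x * y - φ u * φ v = (x - φ u) * y + φ u * (y - φ v) by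
      rw [sub_mul, mul_sub, sub_add_sub_cancel]]
    exact I.add_mem (I.mul_mem_right _ _ hu) (I.mul_mem_left _ _ hv)
  add_mem' := by
    rintro x y ⟨u, hu⟩ ⟨v, hv⟩
    refine ⟨u + v, ?_⟩
    rw [map_add, add_sub_add_comm]
    exact I.add_mem hu hv
  algebraMap_mem' c := ⟨algebraMap _ _ c, by rw [AlgHom.commutes, sub_self]; exact I.zero_mem⟩

lemma rangeAddIdeal_eq_top (hm : σ.order ∈ ({1, 2, 3} : Set ℕ))
    (hζ : IsPrimitiveRoot ζ σ.order) (hO : IsOrbitReps σ O) (hchar : ringChar F ≠ σ.order)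
    (hφ : IsInducedByInclusion σ χ φ) {n : ℕ} {a : Fin n → F}
    (ha : ∀ i j, i ≠ j → a i ^ σ.order ≠ a j ^ σ.order) (N : ℕ) :
    rangeAddIdeal φ
      (twistIdeal C ((∏ j, (1 - Polynomial.C (a j) * Polynomial.X)) ^ N)) = ⊤ := by
  have hσ : σ.order ≠ 0 := by rcases hm with h | h | h <;> rw [h] <;> norm_num
  have hp : σ.order = 1 ∨ σ.order.Prime := by
    rcases hm with h | h | h <;> rw [h] <;> norm_num
  have hω := isPrimitiveRoot_zetaImage χ hσ hζ hp hchar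
  set I := twistIdeal C ((∏ j, (1 - Polynomial.C (a j) * Polynomial.X)) ^ N) with hI
  have hφA : φ.range ≤ rangeAddIdeal φ I := by
    rintro _ ⟨u, rfl⟩
    refine ⟨u, ?_⟩
    change φ u - φ u ∈ I
    rw [sub_self]
    exact I.zero_mem
  -- The generators of the ideal are congruent to `φ 0`; this puts the multiples of `h` into every
  -- `divPowSubmodule`.
  have hgen : ∀ (α : H.root) (k : ℤ) (r : ℕ), 0 < r → hyperDivPow C α (LaurentPolynomial.T k *
      Polynomial.toLaurent (tildePoly ((∏ j, (1 - Polynomial.C (a j) * Polynomial.X)) ^ N))) r ∈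
      rangeAddIdeal φ I := fun α k r hr =>
    ⟨0, by rw [map_zero, sub_zero]; exact TwoSidedIdeal.subset_span ⟨α, k, r, hr, rfl⟩⟩
  refine eq_top_of_divPowSubmodule_eq_top fun δ => divPowSubmodule_eq_top hm hσ hζ hω hO hchar hφ
    hφA (fun j hj hjm => isCoprime_scaleLaurent ha N (ω := zetaImage χ hσ hζ.pow_eq_one ^ j)
      ?_ (hω.pow_ne_one_of_pos_of_lt hj.ne' hjm))
      (fun α => mem_divPowSubmodule_of_dvd (hgen α)) δ
  rw [← pow_mul, mul_comm, pow_mul, hω.pow_eq_one, one_pow]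

end Surjective

/-! ### Restriction of modules along a map that is surjective on actions. -/

section Restriction

variable {R R' V : Type*} [Ring R] [Ring R'] [AddCommGroup V] [Module R V]

/-- Each `x` in `R` acts as some `f u`, so the `R'`-span is already stable under `R`. -/
lemma span_compHom_eq_top (f : R' →+* R) (hf : ∀ x : R, ∃ u, ∀ v : V, x • v = f u • v)
    {S : Set V} (hS : Submodule.span R S = ⊤) :
    letI : Module R' V := Module.compHom V f
    Submodule.span R' S = ⊤ := by
  let : Module R' V := Module.compHom V f
  let W : Submodule R V :=
    { (Submodule.span R' S).toAddSubmonoid with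
      smul_mem' := fun x v hv => by
        obtain ⟨u, hu⟩ := hf x
        rw [hu]
        exact (Submodule.span R' S).smul_mem u hv }
  have hW : W = ⊤ := top_le_iff.mp (hS ▸ Submodule.span_le.mpr fun v hv =>
    show v ∈ Submodule.span R' S from Submodule.subset_span hv)
  exact eq_top_iff.mpr fun v _ => show v ∈ W from hW ▸ Submodule.mem_top

lemma isSimpleModule_compHom (f : R' →+* R) (hf : ∀ x : R, ∃ u, ∀ v : V, x • v = f u • v)
    (hV : IsSimpleModule R V) :
    letI : Module R' V := Module.compHom V f
    IsSimpleModule R' V := by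
  let : Module R' V := Module.compHom V f
  rw [isSimpleModule_iff_toSpanSingleton_surjective] at hV ⊢
  refine ⟨hV.1, fun v hv w => ?_⟩
  obtain ⟨x, hx⟩ := hV.2 v hv w
  obtain ⟨u, hu⟩ := hf x
  exact ⟨u, (hu v).symm.trans hx⟩

end Restriction

end TwistedHyperLoop

end

open TwistedHyperLoop LieAlgebra.IsKilling in
theorem proposition4p3
    {L : Type*} [LieRing L] [LieAlgebra ℂ L] [FiniteDimensional ℂ L] [LieAlgebra.IsSimple ℂ L]
    (H : LieSubalgebra ℂ L) [H.IsCartanSubalgebra]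
    (b : (rootSystem H).Base) (C : ChevalleyBasis H) (σ : DiagramAut b C)
    (hm : σ.order ∈ ({1, 2, 3} : Set ℕ))
    (ζ : ℂˣ) (hζ : IsPrimitiveRoot ζ σ.order)
    (O : Set H.root) (hO : IsOrbitReps σ O)
    {F : Type*} [Field F] [IsAlgClosed F] (hchar : ringChar F ≠ σ.order)
    (χ : coeffRing ζ →+* F) :
    ∃ φ : TwistedHyper σ ζ O F →ₐ[F] HyperLoop C F,
      IsInducedByInclusion σ χ φ ∧
      (∀ φ' : TwistedHyper σ ζ O F →ₐ[F] HyperLoop C F, IsInducedByInclusion σ χ φ' → φ' = φ) ∧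
      ∀ (n : ℕ) (a : Fin n → F), (∀ i j, i ≠ j → a i ^ σ.order ≠ a j ^ σ.order) →
        ∀ (f : Polynomial F), f = ∏ j, (1 - Polynomial.C (a j) * Polynomial.X) →
        ∀ N : ℕ,
          Function.Surjective
            (fun u : TwistedHyper σ ζ O F => (twistIdeal C (f ^ N)).ringCon.mk' (φ u)) ∧
          ∀ (V : Type*) [AddCommGroup V] [Module (HyperLoop C F) V],
            (∀ x ∈ twistIdeal C (f ^ N), ∀ v : V, x • v = 0) →
            letI : Module (TwistedHyper σ ζ O F) V := Module.compHom V φ.toRingHom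
            (∀ S : Set V, Submodule.span (HyperLoop C F) S = ⊤ →
              Submodule.span (TwistedHyper σ ζ O F) S = ⊤) ∧
            (IsSimpleModule (HyperLoop C F) V → IsSimpleModule (TwistedHyper σ ζ O F) V) := by
  have hσ : σ.order ≠ 0 := by rcases hm with h | h | h <;> rw [h] <;> norm_num
  have hφ := isInducedByInclusion_hyperInclusion hσ hζ.pow_eq_one hm O χ
  refine ⟨hyperInclusion hσ hζ.pow_eq_one hm O χ, hφ,
    fun φ' hφ' => isInducedByInclusion_unique hφ hφ', ?_⟩
  rintro n a ha _ rfl N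
  have key : ∀ x : HyperLoop C F, ∃ u, x - hyperInclusion hσ hζ.pow_eq_one hm O χ u ∈
      twistIdeal C ((∏ j, (1 - Polynomial.C (a j) * Polynomial.X)) ^ N) := fun x =>
    show x ∈ rangeAddIdeal _ _ from
      rangeAddIdeal_eq_top hm hζ hO hchar hφ ha N ▸ Algebra.mem_top
  refine ⟨fun y => ?_, fun V _ _ hV => ?_⟩
  · obtain ⟨x, rfl⟩ := RingCon.mk'_surjective _ y
    obtain ⟨u, hu⟩ := key x
    exact ⟨u, ((RingCon.eq _).mpr ((TwoSidedIdeal.rel_iff _ _ _).mpr hu)).symm⟩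
  -- The difference `x - φ u` lies in the ideal, which annihilates `V`.
  · have hact : ∀ x : HyperLoop C F, ∃ u, ∀ v : V,
        x • v = (hyperInclusion hσ hζ.pow_eq_one hm O χ).toRingHom u • v := fun x => by
      obtain ⟨u, hu⟩ := key x
      exact ⟨u, fun v => sub_eq_zero.mp ((sub_smul _ _ _).symm.trans (hV _ hu v))⟩
    exact ⟨fun S hS => span_compHom_eq_top _ hact hS, isSimpleModule_compHom _ hact⟩
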